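/- **Setting.** Let $(Y,d)$ be a compact metric space with $\operatorname{diam}Y\le 1$ which is an $m$-dimensional manifold whose metric is locally bi-Lipschitz equivalent to the Euclidean one: every point of $Y$ has an open neighbourhood that is bi-Lipschitz homeomorphic to an open subset of $\mathbb R^m$ (for instance, the distance of a Riemannian metric). Let $\mu$ be a Borel probability measure on $Y$ such that, for some $k>0$, $\sup_{y\in Y}\mu(B_d(y,r))=O(r^k)$ as $r\to0$. Let $\Gamma$ be a group generated by a finite set $S$, with word length $|\cdot|$, which acts on $Y$ by measure preserving Lipschitz homeomorphisms. Equip $Y\times[1,\infty)$ with the cone metric $d_{\mathrm{Cone}}((x,s),(y,t))=|s-t|+\min(s,t)\,d(x,y)$, so that $d_{\mathrm{Cone}}((x,t),(y,t))=t\,d(x,y)$. The warped cone $\mathcal O_\Gamma Y$ is the set $Y\times[1,\infty)$ with the largest metric $d_\Gamma$ such that $d_\Gamma\le d_{\mathrm{Cone}}$ and $d_\Gamma((y,t),(\gamma y,t))\le|\gamma|$ for all $(y,t)$ and all $\gamma\in\Gamma$. A $1$-net of a metric space $X$ is a subset $N$ such that every point of $X$ is at distance at most $1$ from some point of $N$.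 For a Banach space $E$, the $E$-distortion $c_E(X)\in[0,\infty]$ is the infimum, over all bi-Lipschitz embeddings $f\colon X\to E$, of $$\sup_{x\ne y}\frac{\|f(x)-f(y)\|}{d(x,y)}\cdot\sup_{x\neq y}\frac{d(x,y)}{\|f(x)-f(y)\|}$$ ($\infty$ if there is no such $f$, and $0$ if $X$ is a single point); $c_2=c_{\ell_2}$. For $1<p<\infty$, the action has a spectral gap on $L_p(Y,\mu;E)$ if there is $\kappa>0$ with $\sup_{s\in S}\|f-\pi_sf\|\ge\kappa\|f\|$ for all $f\in L_p(Y,\mu;E)$ with $\int_Y f\,d\mu=0$, where $\pi_s f(y)=f(s^{-1}y)$. **Statement.** 1. There are constants $a,b>0$ such that for every $t\ge1$ there is a finite $1$-net $Z_t$ of $Y\times\{t\}$ with respect to $d_{\mathrm{Cone}}$, and consequently with respect to $d_\Gamma$, with $a\,t^m\le|Z_t|\le b\,t^m$. 2. Let $E$ be a Banach space and $1<p<\infty$ such that the action has a spectral gap on $L_p(Y,\mu;E)$. Then for every $A$ there is a constant $c>0$ such that for all $t\ge1$ and every finite $1$-net $Z_t$ of $(Y\times\{t\},d_\Gamma)$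 with $|Z_t|\le A\,t^m$, $$c_E(Z_t)\ \ge\ c\,\log|Z_t|,$$ where $Z_t$ carries the metric $d_\Gamma$. 3. There is a universal constant $C>0$ such that, if $E=\ell_2$ in 2, then $c\,\log|Z_t|\le c_2(Z_t)\le C\log|Z_t|$ for all $t$ and $Z_t$ as in 2. Thus $c_2(Z_t)\asymp\log|Z_t|$, and the Euclidean distortion of the nets realizes Bourgain's upper bound. -/

import Mathlib

open MeasureTheory Filter Topology
open scoped NNReal ENNReal

noncomputable section

/-- Word length of `γ` with respect to `S`: the least length of a word in `S ∪ S⁻¹` with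
value `γ`. -/
def wordLength {Γ : Type*} [Group Γ] (S : Finset Γ) (γ : Γ) : ℕ :=
  sInf {n : ℕ | ∃ l : List Γ, (∀ g ∈ l, g ∈ S ∨ g⁻¹ ∈ S) ∧ l.prod = γ ∧ l.length = n}

theorem eq_one_of_wordLength_eq_zero {Γ : Type*} [Group Γ] {S : Finset Γ}
    (hS : Subgroup.closure (S : Set Γ) = ⊤) {γ : Γ} (h : wordLength S γ = 0) : γ = 1 := by
  have hγ : γ ∈ Submonoid.closure ((S : Set Γ) ∪ (S : Set Γ)⁻¹) := by
    rw [← Subgroup.closure_toSubmonoid, hS]; trivial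
  obtain ⟨l, hl, hp⟩ := Submonoid.exists_list_of_mem_closure hγ
  rcases Nat.sInf_eq_zero.mp h with ⟨l', -, hp', h0⟩ | h0
  · rw [List.length_eq_zero_iff] at h0
    subst h0
    simpa using hp'.symm
  · exact absurd (show l.length ∈ (∅ : Set ℕ) from h0 ▸ ⟨l, hl, hp, rfl⟩) (by simp)

/-- The distance of the truncated cone over `Y`, on the set `Y × [1, ∞)`; on the level `t` it
is `t * dist x y`. -/
def coneDist {Y : Type*} [MetricSpace Y] (w w' : Y × Set.Ici (1 : ℝ)) : ℝ :=
  |(w.2 : ℝ) - w'.2| + min (w.2 : ℝ) w'.2 * dist w.1 w'.1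

/-- `ρ` is a metric on `Y × [1, ∞)` which is at most the cone distance and for which `γ` moves
every point by at most the word length of `γ`. The action is `γ (y, t) = (γ y, t)`. -/
structure IsWarpedMetric {Γ Y : Type*} [Group Γ] [MetricSpace Y] [MulAction Γ Y] (S : Finset Γ)
    (ρ : Y × Set.Ici (1 : ℝ) → Y × Set.Ici (1 : ℝ) → ℝ) : Prop where
  self : ∀ w, ρ w w = 0
  eq_of_zero : ∀ w w', ρ w w' = 0 → w = w'
  comm : ∀ w w', ρ w w' = ρ w' w
  triangle : ∀ w w' w'', ρ w w'' ≤ ρ w w' + ρ w' w''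
  le_coneDist : ∀ w w', ρ w w' ≤ coneDist w w'
  le_wordLength : ∀ (γ : Γ) (w), ρ w (γ • w.1, w.2) ≤ wordLength S γ

/-- The largest metric among those of `IsWarpedMetric` (see `isGreatest_warpedDist`). -/
def warpedDist {Γ Y : Type*} [Group Γ] [MetricSpace Y] [MulAction Γ Y] (S : Finset Γ)
    (w w' : Y × Set.Ici (1 : ℝ)) : ℝ :=
  sSup {r : ℝ | ∃ ρ : Y × Set.Ici (1 : ℝ) → Y × Set.Ici (1 : ℝ) → ℝ,
    IsWarpedMetric S ρ ∧ ρ w w' = r}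

theorem exists_isWarpedMetric {Γ Y : Type*} [Group Γ] [MetricSpace Y] [MulAction Γ Y]
    {S : Finset Γ} (hS : Subgroup.closure (S : Set Γ) = ⊤) :
    ∃ ρ : Y × Set.Ici (1 : ℝ) → Y × Set.Ici (1 : ℝ) → ℝ, IsWarpedMetric S ρ := by
  refine ⟨fun w w' => min 1 (|(w.2 : ℝ) - w'.2| + dist w.1 w'.1), ?_, ?_, ?_, ?_, ?_, ?_⟩
  · intro w; simp
  · rintro ⟨x, s⟩ ⟨y, t⟩ h
    have h1 : |(s : ℝ) - t| + dist x y ≤ 0 := by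
      rcases min_choice (1 : ℝ) (|(s : ℝ) - t| + dist x y) with h' | h'
      · rw [h'] at h; norm_num at h
      · rw [h'] at h; exact h.le
    have h2 := abs_nonneg ((s : ℝ) - t)
    have h3 := dist_nonneg (x := x) (y := y)
    have h4 : x = y := dist_le_zero.mp (by linarith)
    have h5 : (s : ℝ) = t := sub_eq_zero.mp (abs_eq_zero.mp (by linarith))
    exact Prod.ext h4 (Subtype.ext h5)
  · intro w w'
    simp only [abs_sub_comm (w.2 : ℝ), dist_comm w.1]
  · intro w w' w''
    have h1 := abs_sub_le (w.2 : ℝ) w'.2 w''.2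
    have h2 := dist_triangle w.1 w'.1 w''.1
    have h3 := abs_nonneg ((w.2 : ℝ) - w'.2)
    have h4 := abs_nonneg ((w'.2 : ℝ) - w''.2)
    have h5 := dist_nonneg (x := w.1) (y := w'.1)
    have h6 := dist_nonneg (x := w'.1) (y := w''.1)
    simp only [min_def]
    split_ifs <;> linarith
  · intro w w'
    refine (min_le_right _ _).trans (add_le_add le_rfl ?_)
    exact le_mul_of_one_le_left dist_nonneg (le_min w.2.2 w'.2.2)
  · intro γ w
    rcases Nat.eq_zero_or_pos (wordLength S γ) with h | h
    · simp [eq_one_of_wordLength_eq_zero hS h]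
    · exact (min_le_left _ _).trans (by exact_mod_cast h)

theorem isGreatest_warpedDist {Γ Y : Type*} [Group Γ] [MetricSpace Y] [MulAction Γ Y]
    {S : Finset Γ} (hS : Subgroup.closure (S : Set Γ) = ⊤) :
    IsGreatest {ρ : Y × Set.Ici (1 : ℝ) → Y × Set.Ici (1 : ℝ) → ℝ | IsWarpedMetric S ρ}
      (warpedDist S) := by
  obtain ⟨ρ₀, h₀⟩ := exists_isWarpedMetric (Y := Y) hS
  have hle : ∀ ρ : Y × Set.Ici (1 : ℝ) → Y × Set.Ici (1 : ℝ) → ℝ, IsWarpedMetric S ρ →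
      ∀ w w', ρ w w' ≤ warpedDist S w w' := fun ρ h w w' =>
    le_csSup ⟨coneDist w w', by rintro _ ⟨ρ, h, rfl⟩; exact h.le_coneDist w w'⟩ ⟨ρ, h, rfl⟩
  have hsup : ∀ w w' : Y × Set.Ici (1 : ℝ), ∀ b : ℝ,
      (∀ ρ : Y × Set.Ici (1 : ℝ) → Y × Set.Ici (1 : ℝ) → ℝ, IsWarpedMetric S ρ → ρ w w' ≤ b) →
      warpedDist S w w' ≤ b := fun w w' b h =>
    csSup_le ⟨_, ρ₀, h₀, rfl⟩ (by rintro _ ⟨ρ, hρ, rfl⟩; exact h ρ hρ)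
  have hnn : ∀ w w' : Y × Set.Ici (1 : ℝ), 0 ≤ ρ₀ w w' := fun w w' => by
    have := h₀.triangle w w' w
    rw [h₀.self, h₀.comm w' w] at this
    linarith
  refine ⟨⟨?_, ?_, ?_, ?_, ?_, ?_⟩, fun ρ h w w' => hle ρ h w w'⟩
  · exact fun w => le_antisymm (hsup _ _ _ fun ρ h => (h.self w).le)
      ((hnn w w).trans (hle ρ₀ h₀ w w))
  · exact fun w w' h => h₀.eq_of_zero w w' (le_antisymm (h ▸ hle ρ₀ h₀ w w') (hnn w w'))
  · exact fun w w' => le_antisymm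
      (hsup _ _ _ fun ρ h => (h.comm w w').le.trans (hle ρ h w' w))
      (hsup _ _ _ fun ρ h => (h.comm w' w).le.trans (hle ρ h w w'))
  · exact fun w w' w'' => hsup _ _ _ fun ρ h =>
      (h.triangle w w' w'').trans (add_le_add (hle ρ h _ _) (hle ρ h _ _))
  · exact fun w w' => hsup _ _ _ fun ρ h => h.le_coneDist w w'
  · exact fun γ w => hsup _ _ _ fun ρ h => h.le_wordLength γ w

/-- The warped cone `𝒪_Γ Y`, where `Γ` is generated by the finite set `S`: the set `Y × [1, ∞)`
with the metric `warpedDist S`. -/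
def WarpedCone (Y : Type*) {Γ : Type*} [Group Γ] (S : Finset Γ)
    (_hS : Subgroup.closure (S : Set Γ) = ⊤) : Type _ :=
  Y × Set.Ici (1 : ℝ)

instance WarpedCone.instMetricSpace {Y Γ : Type*} [Group Γ] [MetricSpace Y] [MulAction Γ Y]
    (S : Finset Γ) (hS : Subgroup.closure (S : Set Γ) = ⊤) : MetricSpace (WarpedCone Y S hS) where
  dist := warpedDist S
  dist_self := (isGreatest_warpedDist hS).1.self
  dist_comm := (isGreatest_warpedDist hS).1.comm
  dist_triangle := (isGreatest_warpedDist hS).1.triangle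
  eq_of_dist_eq_zero := fun h => (isGreatest_warpedDist hS).1.eq_of_zero _ _ h

/-- The level set `Y × {t}` of the warped cone. -/
def WarpedCone.level {Y Γ : Type*} [Group Γ] {S : Finset Γ}
    {hS : Subgroup.closure (S : Set Γ) = ⊤} (t : Set.Ici (1 : ℝ)) : Set (WarpedCone Y S hS) :=
  {w | w.2 = t}

/-- `N` is a `C`-net in the set `A` with respect to the distance function `d`. -/
def IsNet {X : Type*} (d : X → X → ℝ) (C : ℝ) (A N : Set X) : Prop :=
  N ⊆ A ∧ ∀ a ∈ A, ∃ x ∈ N, d x a ≤ C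

/-- `f` is a bi-Lipschitz embedding. -/
def IsBiLipschitz {X E : Type*} [MetricSpace X] [MetricSpace E] (f : X → E) : Prop :=
  ∃ K : ℝ≥0, LipschitzWith K f ∧ AntilipschitzWith K f

/-- The distortion of the map `f`; the suprema are over pairs of distinct points, and a supremum
over no pair is `0`. -/
def mapDistortion {X E : Type*} [MetricSpace X] [MetricSpace E] (f : X → E) : ℝ≥0∞ :=
  (⨆ (x : X) (y : X) (_ : x ≠ y), edist (f x) (f y) / edist x y) *
    (⨆ (x : X) (y : X) (_ : x ≠ y), edist x y / edist (f x) (f y))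

/-- The `E`-distortion of `X`; it is `∞` if `X` has no bi-Lipschitz embedding into `E`. -/
def distortion (E X : Type*) [MetricSpace X] [MetricSpace E] : ℝ≥0∞ :=
  ⨅ (f : X → E) (_ : IsBiLipschitz f), mapDistortion f

/-- The representation `(π_γ f)(y) = f (γ⁻¹ y)` of `Γ` on `L_p(Y, μ; E)` has a spectral gap:
`sup_{s ∈ S} ‖f - π_s f‖ ≥ κ ‖f‖` for some `κ > 0` and all `f` of mean zero. -/
def HasSpectralGap {Γ Y : Type*} [Group Γ] [MulAction Γ Y] [MeasurableSpace Y] (S : Finset Γ)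
    (μ : Measure Y) (p : ℝ≥0∞) (E : Type*) [NormedAddCommGroup E] [NormedSpace ℝ E] : Prop :=
  ∃ κ : ℝ, 0 < κ ∧ ∀ f : Y → E, MemLp f p μ → ∫ y, f y ∂μ = 0 →
    ENNReal.ofReal κ * eLpNorm f p μ ≤ ⨆ s ∈ S, eLpNorm (fun y => f y - f (s⁻¹ • y)) p μ

/-- `Y` is an `n`-dimensional manifold and its metric is locally bi-Lipschitz equivalent to the
Euclidean one, as it is for the distance of any Riemannian metric: every point lies in the domain
of a bi-Lipschitz chart onto an open subset of `ℝⁿ`. -/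
def IsMetricManifold (n : ℕ) (Y : Type*) [MetricSpace Y] : Prop :=
  ∀ y : Y, ∃ e : OpenPartialHomeomorph Y (EuclideanSpace ℝ (Fin n)), y ∈ e.source ∧
    ∃ K : ℝ≥0, LipschitzOnWith K e e.source ∧ LipschitzOnWith K e.symm e.target

end

/-! Lower bound: let `f` embed a net `Z` of the level `t` with constants `L` (Lipschitz) and `M`
(inverse). Composing `f` with a measurable choice of nearby net points gives a simple function `F`
on `Y`. Generators move points by at most 1 in the warped metric, so they change `F` by at most
`3L`. The spectral gap bounds the `L_p` distance of `F` to its mean by `3L/κ`, and by Markov's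
inequality half of `Y` is mapped within `6L/κ` of the mean. Pulled back through `f`, half of the
level lies in one warped ball of radius `O(LM)` (`half_le_measureReal_warped_ball`).

Such balls are small: one of radius `R` is covered by exponentially many (in `R`) balls of `Y`,
centred at translates of its centre and of radius `exp(O(R)) / t`, so its measure is at most `C
exp(βR) t^(-k)` (`exists_measureReal_warped_ball_le`). Hence `LM` is at least of order `log t`, up
to constants absorbed by `LM ≥ 1`, and `log t` controls `log |Z|` because `|Z| ≤ A t^n`. The
covering needs a lower bound for the warped metric. As that metric is a supremum, it is enough to
exhibit one competitor, built from `WarpedClose`.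

Upper bound: this is Bourgain's theorem, with coordinates the distances to random subsets at all
dyadic densities (`dist_div_le_sum_infDist`). The nets are maximal `1/t`-separated subsets of `Y`,
counted by comparing Euclidean volumes in charts. -/

/-! ### Random subsets and Bourgain's embedding -/

/-- The weight of `A` for the random subset of `X` that contains each point independently with
probability `q`. -/
def bernoulliWeight {X : Type*} [Fintype X] (q : ℝ) (A : Finset X) : ℝ :=
  q ^ A.card * (1 - q) ^ (Fintype.card X - A.card)

theorem bernoulliWeight_nonneg {X : Type*} [Fintype X] {q : ℝ} (h0 : 0 ≤ q) (h1 : q ≤ 1)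
    (A : Finset X) : 0 ≤ bernoulliWeight q A :=
  mul_nonneg (pow_nonneg h0 _) (pow_nonneg (by linarith) _)

theorem sum_bernoulliWeight {X : Type*} [Fintype X] (q : ℝ) :
    ∑ A : Finset X, bernoulliWeight q A = 1 := by
  have h := Finset.sum_pow_mul_eq_add_pow q (1 - q) (Finset.univ : Finset X)
  simpa [bernoulliWeight] using h

theorem sum_bernoulliWeight_disjoint {X : Type*} [Fintype X] [DecidableEq X] (q : ℝ)
    (U : Finset X) :
    ∑ A : Finset X with Disjoint A U, bernoulliWeight q A = (1 - q) ^ U.card := by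
  have hset : (Finset.univ.filter fun A : Finset X => Disjoint A U) = Uᶜ.powerset := by
    ext A
    simp [Finset.subset_compl_iff_disjoint_right]
  rw [hset]
  have h := Finset.sum_pow_mul_eq_add_pow q (1 - q) Uᶜ
  have hU : U.card + Uᶜ.card = Fintype.card X := Finset.card_add_card_compl U
  calc ∑ A ∈ Uᶜ.powerset, bernoulliWeight q A
      = ∑ A ∈ Uᶜ.powerset, (1 - q) ^ U.card * (q ^ A.card * (1 - q) ^ (Uᶜ.card - A.card)) := by
        refine Finset.sum_congr rfl fun A hA => ?_
        have hA' := Finset.card_le_card (Finset.mem_powerset.mp hA)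
        have : Fintype.card X - A.card = U.card + (Uᶜ.card - A.card) := by omega
        rw [bernoulliWeight, this, pow_add]
        ring
    _ = (1 - q) ^ U.card := by
        rw [← Finset.mul_sum, h]
        simp

theorem sum_bernoulliWeight_disjoint_not_disjoint {X : Type*} [Fintype X] [DecidableEq X] (q : ℝ)
    {U V : Finset X} (hUV : Disjoint U V) :
    ∑ A : Finset X with Disjoint A U ∧ ¬ Disjoint A V, bernoulliWeight q A
      = (1 - q) ^ U.card * (1 - (1 - q) ^ V.card) := by
  have h1 := sum_bernoulliWeight_disjoint q U
  have h2 := sum_bernoulliWeight_disjoint q (U ∪ V)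
  rw [← Finset.sum_filter_add_sum_filter_not _ (fun A => Disjoint A V)] at h1
  simp only [Finset.filter_filter, ← Finset.disjoint_union_right] at h1
  rw [h2, Finset.card_union_of_disjoint hUV, pow_add] at h1
  linarith

theorem quarter_le_one_sub_pow {i u : ℕ} (hu : u ≤ 2 ^ (i + 1)) :
    1 / 4 ≤ (1 - ((2 : ℝ) ^ (i + 1))⁻¹) ^ u := by
  have hp : (0 : ℝ) < 2 ^ i := by positivity
  have hq1 : ((2 : ℝ) ^ (i + 1))⁻¹ ≤ 1 := inv_le_one_of_one_le₀ (one_le_pow₀ (by norm_num))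
  have hq0 : (0 : ℝ) < ((2 : ℝ) ^ (i + 1))⁻¹ := by positivity
  -- Bernoulli's inequality is useless at exponent `2 ^ (i + 1)`, where it gives `0`; at half that
  -- exponent it gives `1/2`, which is then squared.
  have hb : 1 / 2 ≤ (1 - ((2 : ℝ) ^ (i + 1))⁻¹) ^ (2 ^ i) := by
    have h := one_add_mul_le_pow (a := -((2 : ℝ) ^ (i + 1))⁻¹) (by linarith) (2 ^ i)
    have h' : (1 : ℝ) + ((2 ^ i : ℕ) : ℝ) * -((2 : ℝ) ^ (i + 1))⁻¹ = 1 / 2 := by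
      push_cast
      rw [pow_succ]
      field_simp
      norm_num
    rw [h'] at h
    simpa [sub_eq_add_neg] using h
  calc (1 : ℝ) / 4 = (1 / 2) ^ 2 := by norm_num
    _ ≤ ((1 - ((2 : ℝ) ^ (i + 1))⁻¹) ^ (2 ^ i)) ^ 2 := by gcongr
    _ = (1 - ((2 : ℝ) ^ (i + 1))⁻¹) ^ (2 ^ (i + 1)) := by rw [← pow_mul, ← pow_succ]
    _ ≤ _ := pow_le_pow_of_le_one (by linarith) (by linarith) hu

theorem one_sub_pow_le_two_thirds {i v : ℕ} (hv : 2 ^ i ≤ v) :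
    (1 - ((2 : ℝ) ^ (i + 1))⁻¹) ^ v ≤ 2 / 3 := by
  set q := ((2 : ℝ) ^ (i + 1))⁻¹ with hq
  have hp : (0 : ℝ) < 2 ^ i := by positivity
  have hq1 : q ≤ 1 := inv_le_one_of_one_le₀ (one_le_pow₀ (by norm_num))
  have hq0 : 0 < q := by positivity
  have h1 : 1 + (v : ℝ) * q ≤ (1 + q) ^ v := one_add_mul_le_pow (by linarith) v
  have h2 : 1 / 2 ≤ (v : ℝ) * q := by
    have : (2 : ℝ) ^ i ≤ v := by exact_mod_cast hv
    calc (1 : ℝ) / 2 = 2 ^ i * q := by rw [hq, pow_succ]; field_simp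
      _ ≤ _ := by gcongr
  -- An upper bound for `(1 - q) ^ v` follows from `(1 + q) ^ v ≥ 3/2`, since `(1 - q)(1 + q) ≤ 1`.
  have h3 : (1 - q) ^ v * (1 + q) ^ v ≤ 1 := by
    rw [← mul_pow]
    exact pow_le_one₀ (mul_nonneg (by linarith) (by linarith)) (by nlinarith)
  have h4 : 0 ≤ (1 - q) ^ v := pow_nonneg (by linarith) v
  nlinarith

/-- A random subset of density comparable to `1 / |U|` avoids `U` and meets `V` with probability
bounded below. -/
theorem twelfth_le_sum_bernoulliWeight {X : Type*} [Fintype X] [DecidableEq X]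
    {U V : Finset X} (hUV : Disjoint U V) (hU : U.Nonempty) (hle : U.card ≤ V.card) :
    1 / 12 ≤ ∑ A : Finset X with Disjoint A U ∧ ¬ Disjoint A V,
      bernoulliWeight ((2 : ℝ) ^ (Nat.log 2 U.card + 1))⁻¹ A := by
  rw [sum_bernoulliWeight_disjoint_not_disjoint _ hUV]
  have h1 := quarter_le_one_sub_pow (Nat.lt_pow_succ_log_self one_lt_two U.card).le
  have h2 := one_sub_pow_le_two_thirds
    ((Nat.pow_log_le_self 2 (Finset.card_pos.mpr hU).ne').trans hle)
  nlinarith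

theorem infDist_le_iff_not_disjoint {X : Type*} [MetricSpace X] [Fintype X] [DecidableEq X]
    {A : Finset X} (hA : A.Nonempty) (x : X) (r : ℝ) :
    Metric.infDist x (A : Set X) ≤ r ↔
      ¬ Disjoint A (Finset.univ.filter fun z => dist z x ≤ r) := by
  rw [Finset.not_disjoint_iff]
  constructor
  · intro h
    obtain ⟨a, ha, h'⟩ := A.finite_toSet.isCompact.exists_infDist_eq_dist hA x
    exact ⟨a, ha, by simpa [dist_comm a x, ← h'] using h⟩
  · rintro ⟨a, ha, h⟩
    have h' : dist a x ≤ r := by simpa using h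
    exact (Metric.infDist_le_dist_of_mem (Finset.mem_coe.mpr ha)).trans (by rwa [dist_comm])

/-- The closed balls of radius `r` about `x` and `y` are disjoint. At the dyadic density matched to
the one with fewer points, a random `A` misses that ball and meets the other with probability at
least `1/12`, and then `r` separates the two distances to `A`. The sum over all densities is there
because the right density depends on `r`. -/
theorem twelfth_le_sum_indicator {X : Type*} [MetricSpace X] [Fintype X] {x y : X} {r : ℝ}
    (hr : 0 ≤ r) (hxy : 2 * r < dist x y) :
    1 / 12 ≤ ∑ j ∈ Finset.range (Nat.log 2 (Fintype.card X) + 1), ∑ A : Finset X,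
      bernoulliWeight ((2 : ℝ) ^ (j + 1))⁻¹ A *
        (Set.Ico (min (Metric.infDist x (A : Set X)) (Metric.infDist y (A : Set X)))
          (max (Metric.infDist x (A : Set X)) (Metric.infDist y (A : Set X)))).indicator 1 r := by
  classical
  wlog hle : (Finset.univ.filter fun z => dist z x ≤ r).card ≤
    (Finset.univ.filter fun z => dist z y ≤ r).card generalizing x y
  · have := this (x := y) (y := x) (by rwa [dist_comm]) (le_of_not_ge hle)
    simpa only [min_comm, max_comm] using this
  set U := Finset.univ.filter fun z => dist z x ≤ r with hUdef
  set V := Finset.univ.filter fun z => dist z y ≤ r with hVdef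
  have hU : U.Nonempty := ⟨x, by simp [U, hr]⟩
  have hUV : Disjoint U V := by
    rw [Finset.disjoint_left]
    intro z hz hz'
    simp only [U, V, Finset.mem_filter, Finset.mem_univ, true_and] at hz hz'
    have := dist_triangle_left x y z
    linarith
  have hw : ∀ j : ℕ, ∀ A : Finset X, 0 ≤ bernoulliWeight ((2 : ℝ) ^ (j + 1))⁻¹ A := fun j A =>
    bernoulliWeight_nonneg (by positivity)
      (inv_le_one_of_one_le₀ (one_le_pow₀ (by norm_num))) A
  have hnn : ∀ j : ℕ, ∀ A : Finset X, 0 ≤ bernoulliWeight ((2 : ℝ) ^ (j + 1))⁻¹ A *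
        (Set.Ico (min (Metric.infDist x (A : Set X)) (Metric.infDist y (A : Set X)))
          (max (Metric.infDist x (A : Set X)) (Metric.infDist y (A : Set X)))).indicator 1 r :=
    fun j A => mul_nonneg (hw j A) (Set.indicator_nonneg (fun _ _ => zero_le_one) _)
  refine (twelfth_le_sum_bernoulliWeight hUV hU hle).trans ?_
  have hj : Nat.log 2 U.card ∈ Finset.range (Nat.log 2 (Fintype.card X) + 1) :=
    Finset.mem_range_succ_iff.mpr (Nat.log_mono_right (Finset.card_le_univ U))
  refine le_trans ?_ (Finset.single_le_sum (fun j _ => Finset.sum_nonneg fun A _ => hnn j A) hj)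
  rw [Finset.sum_filter]
  refine Finset.sum_le_sum fun A _ => ?_
  split_ifs with h
  -- Nonemptiness matters: `infDist` to the empty set is `0`, although the empty set meets no ball.
  · have hA : A.Nonempty := by
      by_contra h0
      rw [Finset.not_nonempty_iff_eq_empty] at h0
      exact h.2 (by simp [h0])
    have h1 : ¬ Metric.infDist x (A : Set X) ≤ r := by
      rw [infDist_le_iff_not_disjoint hA, not_not]; exact h.1
    have h2 : Metric.infDist y (A : Set X) ≤ r := (infDist_le_iff_not_disjoint hA y r).mpr h.2
    rw [Set.indicator_of_mem]
    · simp
    · exact ⟨(min_le_right _ _).trans h2, (not_le.mp h1).trans_le (le_max_left _ _)⟩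
  · exact hnn _ _

/-- Integrate the previous bound over `0 < r < dist x y / 2`: each indicator contributes at most the
length of its interval, which is the difference of the distances to `A`. -/
theorem dist_div_le_sum_infDist {X : Type*} [MetricSpace X] [Fintype X] (x y : X) :
    dist x y / 24 ≤ ∑ j ∈ Finset.range (Nat.log 2 (Fintype.card X) + 1), ∑ A : Finset X,
      bernoulliWeight ((2 : ℝ) ^ (j + 1))⁻¹ A *
        |Metric.infDist x (A : Set X) - Metric.infDist y (A : Set X)| := by
  have hw : ∀ j : ℕ, ∀ A : Finset X, 0 ≤ bernoulliWeight ((2 : ℝ) ^ (j + 1))⁻¹ A := fun j A =>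
    bernoulliWeight_nonneg (by positivity)
      (inv_le_one_of_one_le₀ (one_le_pow₀ (by norm_num))) A
  have hI : ∀ a b : ℝ, IntegrableOn ((Set.Ico a b).indicator (1 : ℝ → ℝ))
      (Set.Ioo 0 (dist x y / 2)) := fun a b =>
    (integrable_const (1 : ℝ)).indicator measurableSet_Ico
  calc dist x y / 24 = ∫ _ in Set.Ioo 0 (dist x y / 2), (1 / 12 : ℝ) := by
        have : (0 : ℝ) ≤ dist x y / 2 := by positivity
        simp [Measure.real, this]
        ring
    _ ≤ ∫ r in Set.Ioo 0 (dist x y / 2), ∑ j ∈ Finset.range (Nat.log 2 (Fintype.card X) + 1),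
        ∑ A : Finset X, bernoulliWeight ((2 : ℝ) ^ (j + 1))⁻¹ A *
        (Set.Ico (min (Metric.infDist x (A : Set X)) (Metric.infDist y (A : Set X)))
          (max (Metric.infDist x (A : Set X)) (Metric.infDist y (A : Set X)))).indicator 1 r := by
        refine setIntegral_mono_on (integrable_const _) ?_ measurableSet_Ioo fun r hr => ?_
        · exact integrable_finsetSum _ fun j _ => integrable_finsetSum _ fun A _ =>
            (hI _ _).const_mul _
        · exact twelfth_le_sum_indicator hr.1.le (by linarith [hr.2])
    _ ≤ _ := by
        rw [integral_finsetSum _ fun j _ => integrable_finsetSum _ fun A _ =>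
            (hI _ _).const_mul _]
        refine Finset.sum_le_sum fun j _ => ?_
        rw [integral_finsetSum _ fun A _ => (hI _ _).const_mul _]
        refine Finset.sum_le_sum fun A _ => ?_
        rw [integral_const_mul]
        refine mul_le_mul_of_nonneg_left ?_ (hw j A)
        rw [setIntegral_indicator measurableSet_Ico]
        simp only [Pi.one_apply, setIntegral_const, smul_eq_mul, mul_one]
        refine (measureReal_mono Set.inter_subset_right (by simp)).trans ?_
        rw [Real.volume_real_Ico_of_le min_le_max, max_sub_min_eq_abs']

/-- A finite family of real functions is the coordinate family of a map to `ℓ₂`. -/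
theorem exists_map_lp_norm_sq {X ι : Type*} [Fintype ι] (g : ι → X → ℝ) :
    ∃ F : X → lp (fun _ : ℕ => ℝ) 2, ∀ x y, ‖F x - F y‖ ^ 2 = ∑ i, (g i x - g i y) ^ 2 := by
  classical
  let e := Fintype.equivFin ι
  let h : ℕ → X → ℝ := fun k x =>
    if hk : k < Fintype.card ι then g (e.symm ⟨k, hk⟩) x else 0
  refine ⟨fun x => ∑ k ∈ Finset.range (Fintype.card ι), lp.single 2 k (h k x), fun x y => ?_⟩
  have hs := lp.norm_sum_single (E := fun _ : ℕ => ℝ) (p := 2) (by simp)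
    (fun k => h k x - h k y) (Finset.range (Fintype.card ι))
  simp only [ENNReal.toReal_ofNat, Real.rpow_ofNat, lp.single_sub, Finset.sum_sub_distrib] at hs
  rw [hs, Finset.sum_range, ← e.symm.sum_comp]
  refine Finset.sum_congr rfl fun k _ => ?_
  simp [h]

/-- The coordinates are the distances to `A` scaled by square roots of the weights, whose total mass
is the number `m` of densities. Each distance function is 1-Lipschitz, which gives `√m`;
Cauchy–Schwarz passes from the weighted `ℓ₁` bound to `ℓ₂` at the cost of another `√m`. -/
theorem exists_map_lp_bourgain (X : Type*) [MetricSpace X] [Fintype X] :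
    ∃ F : X → lp (fun _ : ℕ => ℝ) 2, ∀ x y,
      ‖F x - F y‖ ≤ √(Nat.log 2 (Fintype.card X) + 1 : ℕ) * dist x y ∧
      dist x y ≤ 24 * √(Nat.log 2 (Fintype.card X) + 1 : ℕ) * ‖F x - F y‖ := by
  set m := Nat.log 2 (Fintype.card X) + 1 with hm
  let w : Fin m × Finset X → ℝ := fun i => bernoulliWeight ((2 : ℝ) ^ ((i.1 : ℕ) + 1))⁻¹ i.2
  have hw : ∀ i, 0 ≤ w i := fun i =>
    bernoulliWeight_nonneg (by positivity) (inv_le_one_of_one_le₀ (one_le_pow₀ (by norm_num))) _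
  have hsum : ∑ i, w i = m := by
    simp [Fintype.sum_prod_type, w, sum_bernoulliWeight]
  obtain ⟨F, hF⟩ := exists_map_lp_norm_sq fun (i : Fin m × Finset X) (x : X) =>
    √(w i) * Metric.infDist x (i.2 : Set X)
  have hF' : ∀ x y, ‖F x - F y‖ ^ 2 = ∑ i, w i *
      |Metric.infDist x (i.2 : Set X) - Metric.infDist y (i.2 : Set X)| ^ 2 := fun x y => by
    rw [hF]
    refine Finset.sum_congr rfl fun i _ => ?_
    rw [← mul_sub, mul_pow, Real.sq_sqrt (hw i), sq_abs]
  have habs : ∀ (x y : X) (A : Finset X),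
      |Metric.infDist x (A : Set X) - Metric.infDist y (A : Set X)| ≤ dist x y := fun x y A => by
    have := (Metric.lipschitz_infDist_pt (A : Set X)).dist_le_mul x y
    simpa [Real.dist_eq] using this
  refine ⟨F, fun x y => ⟨?_, ?_⟩⟩
  · refine abs_le_of_sq_le_sq' ?_ (by positivity) |>.2
    rw [mul_pow, Real.sq_sqrt (by positivity), hF', ← hsum, Finset.sum_mul]
    exact Finset.sum_le_sum fun i _ =>
      mul_le_mul_of_nonneg_left (pow_le_pow_left₀ (abs_nonneg _) (habs x y i.2) 2) (hw i)
  · have h1 := dist_div_le_sum_infDist x y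
    have h2 : ∑ j ∈ Finset.range m, ∑ A : Finset X,
        bernoulliWeight ((2 : ℝ) ^ (j + 1))⁻¹ A *
        |Metric.infDist x (A : Set X) - Metric.infDist y (A : Set X)| =
        ∑ i, w i * |Metric.infDist x (i.2 : Set X) - Metric.infDist y (i.2 : Set X)| := by
      rw [Fintype.sum_prod_type, Finset.sum_range]
    rw [← hm, h2] at h1
    have h3 : (∑ i, w i * |Metric.infDist x (i.2 : Set X) - Metric.infDist y (i.2 : Set X)|) ^ 2
        ≤ m * ‖F x - F y‖ ^ 2 := by
      rw [hF', ← hsum]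
      refine Finset.sum_sq_le_sum_mul_sum_of_sq_le_mul _ (fun i _ => hw i)
        (fun i _ => mul_nonneg (hw i) (sq_nonneg _)) fun i _ => le_of_eq (by ring)
    have h4 : (dist x y / 24) ^ 2 ≤ (√(m : ℕ) * ‖F x - F y‖) ^ 2 := by
      rw [mul_pow, Real.sq_sqrt (by positivity)]
      exact (pow_le_pow_left₀ (by positivity) h1 2).trans h3
    have h5 := (abs_le_of_sq_le_sq' h4 (by positivity)).2
    linarith

theorem mapDistortion_le_of_norm_le {X E : Type*} [MetricSpace X] [NormedAddCommGroup E]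
    {F : X → E} {L M : ℝ} (hL : ∀ x y, ‖F x - F y‖ ≤ L * dist x y)
    (hM : ∀ x y, dist x y ≤ M * ‖F x - F y‖) :
    mapDistortion F ≤ ENNReal.ofReal L * ENNReal.ofReal M := by
  refine mul_le_mul' (iSup_le fun x => iSup_le fun y => iSup_le fun hxy => ?_)
    (iSup_le fun x => iSup_le fun y => iSup_le fun hxy => ?_)
  · refine ENNReal.div_le_of_le_mul ?_
    rw [edist_dist, edist_dist, ← ENNReal.ofReal_mul' dist_nonneg, dist_eq_norm]
    exact ENNReal.ofReal_le_ofReal (hL x y)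
  · refine ENNReal.div_le_of_le_mul ?_
    rw [edist_dist, edist_dist, ← ENNReal.ofReal_mul' dist_nonneg, dist_eq_norm]
    exact ENNReal.ofReal_le_ofReal (hM x y)

theorem isBiLipschitz_of_norm_le {X E : Type*} [MetricSpace X] [NormedAddCommGroup E]
    {F : X → E} {L M : ℝ} (hL : ∀ x y, ‖F x - F y‖ ≤ L * dist x y)
    (hM : ∀ x y, dist x y ≤ M * ‖F x - F y‖) : IsBiLipschitz F := by
  refine ⟨max L.toNNReal M.toNNReal, LipschitzWith.of_dist_le_mul fun x y => ?_,
    AntilipschitzWith.of_le_mul_dist fun x y => ?_⟩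
  · rw [dist_eq_norm]
    refine (hL x y).trans (mul_le_mul_of_nonneg_right ?_ dist_nonneg)
    exact (Real.le_coe_toNNReal L).trans (NNReal.coe_le_coe.mpr (le_max_left _ _))
  · rw [dist_eq_norm]
    refine (hM x y).trans (mul_le_mul_of_nonneg_right ?_ (norm_nonneg _))
    exact (Real.le_coe_toNNReal M).trans (NNReal.coe_le_coe.mpr (le_max_right _ _))

theorem distortion_of_subsingleton (E X : Type*) [MetricSpace X] [Subsingleton X]
    [NormedAddCommGroup E] : distortion E X = 0 := by
  have h : ∀ x y : X, ‖(0 : E) - 0‖ ≤ (0 : ℝ) * dist x y := by simp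
  have h' : ∀ x y : X, dist x y ≤ (0 : ℝ) * ‖(0 : E) - 0‖ := fun x y => by
    simp [Subsingleton.elim x y]
  have := mapDistortion_le_of_norm_le (F := fun _ : X => (0 : E)) h h'
  exact le_antisymm ((iInf₂_le _ (isBiLipschitz_of_norm_le h h')).trans (by simpa using this))
    zero_le

/-- Bourgain's embedding theorem. -/
theorem distortion_lp_le_log (X : Type*) [MetricSpace X] [Finite X] [Nonempty X] :
    distortion (lp (fun _ : ℕ => ℝ) 2) X ≤
      ENNReal.ofReal (48 / Real.log 2 * Real.log (Nat.card X)) := by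
  have := Fintype.ofFinite X
  rcases subsingleton_or_nontrivial X with h | h
  · rw [distortion_of_subsingleton]; exact zero_le
  obtain ⟨F, hF⟩ := exists_map_lp_bourgain X
  refine (iInf₂_le F (isBiLipschitz_of_norm_le (fun x y => (hF x y).1)
    fun x y => (hF x y).2)).trans ?_
  refine (mapDistortion_le_of_norm_le (fun x y => (hF x y).1) fun x y => (hF x y).2).trans ?_
  rw [← ENNReal.ofReal_mul (Real.sqrt_nonneg _)]
  refine ENNReal.ofReal_le_ofReal ?_
  set m := Nat.log 2 (Fintype.card X) + 1 with hm
  have h1 : √(m : ℕ) * (24 * √(m : ℕ)) = 24 * m := by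
    rw [mul_left_comm, Real.mul_self_sqrt (by positivity)]
  rw [h1, Nat.card_eq_fintype_card]
  have hcard : 2 ≤ Fintype.card X := Fintype.one_lt_card
  have h2 : 1 ≤ Nat.log 2 (Fintype.card X) := Nat.log_pos one_lt_two hcard
  have h3 : (2 : ℝ) ^ Nat.log 2 (Fintype.card X) ≤ Fintype.card X := by
    exact_mod_cast Nat.pow_log_le_self 2 (by omega)
  have h4 := Real.log_le_log (by positivity) h3
  rw [Real.log_pow] at h4
  have hl : 0 < Real.log 2 := Real.log_pos one_lt_two
  -- With at least two points the extra `1` in `m` is absorbed; this doubles `24` to `48`.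
  have h5 : (m : ℝ) ≤ 2 * (Nat.log 2 (Fintype.card X) : ℝ) := by
    rw [hm]; push_cast
    have : (1 : ℝ) ≤ (Nat.log 2 (Fintype.card X) : ℝ) := by exact_mod_cast h2
    linarith
  rw [div_mul_eq_mul_div, le_div_iff₀ hl]
  nlinarith

/-! ### Word length: exponential growth and Lipschitz constants -/

section WordLength

variable {Γ : Type*} [Group Γ] {S : Finset Γ}

theorem exists_list_length_eq_wordLength (hS : Subgroup.closure (S : Set Γ) = ⊤) (γ : Γ) :
    ∃ l : List Γ, (∀ g ∈ l, g ∈ S ∨ g⁻¹ ∈ S) ∧ l.prod = γ ∧ l.length = wordLength S γ := by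
  have hγ : γ ∈ Submonoid.closure ((S : Set Γ) ∪ (S : Set Γ)⁻¹) := by
    rw [← Subgroup.closure_toSubmonoid, hS]; trivial
  obtain ⟨l, hl, hp⟩ := Submonoid.exists_list_of_mem_closure hγ
  exact Nat.sInf_mem (s := {n : ℕ | ∃ l : List Γ, (∀ g ∈ l, g ∈ S ∨ g⁻¹ ∈ S) ∧
    l.prod = γ ∧ l.length = n}) ⟨l.length, l, hl, hp, rfl⟩

theorem wordLength_prod_le {l : List Γ} (hl : ∀ g ∈ l, g ∈ S ∨ g⁻¹ ∈ S) :
    wordLength S l.prod ≤ l.length :=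
  Nat.sInf_le ⟨l, hl, rfl, rfl⟩

theorem wordLength_one : wordLength S (1 : Γ) = 0 :=
  Nat.le_zero.mp (wordLength_prod_le (S := S) (l := []) (by simp))

theorem wordLength_mul_le (hS : Subgroup.closure (S : Set Γ) = ⊤) (γ γ' : Γ) :
    wordLength S (γ * γ') ≤ wordLength S γ + wordLength S γ' := by
  obtain ⟨l, hl, rfl, h⟩ := exists_list_length_eq_wordLength hS γ
  obtain ⟨l', hl', rfl, h'⟩ := exists_list_length_eq_wordLength hS γ'
  rw [← h, ← h', ← List.prod_append, ← List.length_append]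
  refine wordLength_prod_le fun g hg => ?_
  rcases List.mem_append.mp hg with hg | hg
  exacts [hl g hg, hl' g hg]

theorem wordLength_inv_le (hS : Subgroup.closure (S : Set Γ) = ⊤) (γ : Γ) :
    wordLength S γ⁻¹ ≤ wordLength S γ := by
  obtain ⟨l, hl, rfl, h⟩ := exists_list_length_eq_wordLength hS γ
  rw [← h, List.prod_inv_reverse]
  refine (wordLength_prod_le fun g hg => ?_).trans (by simp)
  obtain ⟨g', hg', rfl⟩ := List.mem_map.mp (List.mem_reverse.mp hg)
  simpa [or_comm] using hl g' hg'

theorem wordLength_inv_le_one {s : Γ} (hs : s ∈ S) : wordLength S s⁻¹ ≤ 1 := by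
  simpa using wordLength_prod_le (S := S) (l := [s⁻¹]) (by simpa using Or.inr hs)

/-- Balls of the word metric grow at most exponentially. -/
theorem exists_finset_wordLength_le (hS : Subgroup.closure (S : Set Γ) = ⊤) :
    ∃ N : ℕ, 1 ≤ N ∧ ∀ n : ℕ, ∃ B : Finset Γ, B.card ≤ N ^ n ∧
      ∀ γ : Γ, wordLength S γ ≤ n → γ ∈ B := by
  classical
  open scoped Pointwise in
  let T : Finset Γ := insert 1 (S ∪ S⁻¹)
  have h1 : (1 : Γ) ∈ T := Finset.mem_insert_self _ _
  refine ⟨T.card, Finset.card_pos.mpr ⟨1, h1⟩, fun n => ?_⟩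
  open scoped Pointwise in
  refine ⟨T ^ n, Finset.card_pow_le, fun γ hγ => ?_⟩
  open scoped Pointwise in
  refine Finset.pow_subset_pow_right h1 hγ ?_
  obtain ⟨l, hl, rfl, h⟩ := exists_list_length_eq_wordLength hS γ
  rw [← h]
  clear h hγ
  induction l with
  | nil => simp
  | cons g l ih =>
    rw [List.prod_cons, List.length_cons, pow_succ']
    refine Finset.mul_mem_mul ?_ (ih fun g' hg' => hl g' (List.mem_cons_of_mem _ hg'))
    have := hl g List.mem_cons_self
    simp only [T, Finset.mem_insert, Finset.mem_union, Finset.mem_inv']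
    tauto

theorem exists_dist_smul_le_exp_wordLength {Y : Type*} [MetricSpace Y] [MulAction Γ Y]
    (hS : Subgroup.closure (S : Set Γ) = ⊤)
    (hL : ∀ γ : Γ, ∃ L : ℝ≥0, LipschitzWith L (fun y : Y => γ • y)) :
    ∃ a : ℝ, 0 ≤ a ∧ ∀ (γ : Γ) (x y : Y),
      dist (γ • x) (γ • y) ≤ Real.exp (a * wordLength S γ) * dist x y := by
  choose L hL using hL
  -- The sum dominates the Lipschitz constant of every generator and inverse generator, and `a ≤ exp
  -- a`.
  refine ⟨∑ s ∈ S, ((L s : ℝ) + L s⁻¹), Finset.sum_nonneg fun s _ => by positivity, ?_⟩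
  set a := ∑ s ∈ S, ((L s : ℝ) + L s⁻¹) with ha
  have hgen : ∀ s ∈ S, (L s : ℝ) + L s⁻¹ ≤ Real.exp a := fun s hs =>
    (Finset.single_le_sum (f := fun s => (L s : ℝ) + L s⁻¹) (fun s _ => by positivity) hs).trans
      (by linarith [Real.add_one_le_exp a])
  have hgen' : ∀ g : Γ, (g ∈ S ∨ g⁻¹ ∈ S) → (L g : ℝ) ≤ Real.exp a := by
    rintro g (hg | hg)
    · linarith [hgen g hg, (L g⁻¹).coe_nonneg]
    · have := hgen _ hg
      rw [inv_inv] at this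
      linarith [(L g⁻¹).coe_nonneg]
  intro γ x y
  obtain ⟨l, hl, rfl, h⟩ := exists_list_length_eq_wordLength hS γ
  rw [← h]
  clear h
  induction l with
  | nil => simp
  | cons g l ih =>
    rw [List.prod_cons, mul_smul, mul_smul, List.length_cons]
    calc dist (g • l.prod • x) (g • l.prod • y)
        ≤ L g * dist (l.prod • x) (l.prod • y) := (hL g).dist_le_mul _ _
      _ ≤ Real.exp a * (Real.exp (a * l.length) * dist x y) := by
        gcongr
        · exact hgen' g (hl g List.mem_cons_self)
        · exact ih fun g' hg' => hl g' (List.mem_cons_of_mem _ hg')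
      _ = _ := by
        rw [← mul_assoc, ← Real.exp_add]
        push_cast
        ring_nf

end WordLength

/-! ### Warped balls and their measure -/

section WarpedBall

variable {Γ Y : Type*} [Group Γ] [MetricSpace Y] [MulAction Γ Y] {S : Finset Γ}

/-- Competitors need not separate points: the maximum with an admissible metric is again admissible.
-/
theorem le_warpedDist (hS : Subgroup.closure (S : Set Γ) = ⊤)
    {ρ : Y × Set.Ici (1 : ℝ) → Y × Set.Ici (1 : ℝ) → ℝ}
    (self : ∀ w, ρ w w = 0) (comm : ∀ w w', ρ w w' = ρ w' w)
    (triangle : ∀ w w' w'', ρ w w'' ≤ ρ w w' + ρ w' w'')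
    (le_coneDist : ∀ w w', ρ w w' ≤ coneDist w w')
    (le_wordLength : ∀ (γ : Γ) (w), ρ w (γ • w.1, w.2) ≤ wordLength S γ)
    (w w' : Y × Set.Ici (1 : ℝ)) : ρ w w' ≤ warpedDist S w w' := by
  obtain ⟨ρ₀, h₀⟩ := exists_isWarpedMetric (Y := Y) hS
  have hnn : ∀ w w', 0 ≤ ρ₀ w w' := fun w w' => by
    have := h₀.triangle w w' w
    rw [h₀.self, h₀.comm w' w] at this
    linarith
  have hmax : IsWarpedMetric S fun w w' => max (ρ w w') (ρ₀ w w') :=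
    { self := fun w => by simp [self, h₀.self]
      eq_of_zero := fun w w' h => h₀.eq_of_zero w w'
        (le_antisymm ((le_max_right _ _).trans h.le) (hnn w w'))
      comm := fun w w' => by rw [comm, h₀.comm]
      triangle := fun w w' w'' => max_le
        ((triangle w w' w'').trans (add_le_add (le_max_left _ _) (le_max_left _ _)))
        ((h₀.triangle w w' w'').trans (add_le_add (le_max_right _ _) (le_max_right _ _)))
      le_coneDist := fun w w' => max_le (le_coneDist w w') (h₀.le_coneDist w w')
      le_wordLength := fun γ w => max_le (le_wordLength γ w) (h₀.le_wordLength γ w) }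
  exact (le_max_left _ _).trans ((isGreatest_warpedDist hS).2 hmax _ _)

/-- Some `γ` of length at most `c` moves `w` close to `w'`. With a suitable `a`, this holds
whenever the warped distance of `w` and `w'` is less than `c`. -/
def WarpedClose (S : Finset Γ) (a c : ℝ) (w w' : Y × Set.Ici (1 : ℝ)) : Prop :=
  ∃ γ : Γ, (wordLength S γ : ℝ) ≤ c ∧ Real.log w.2 - Real.log w'.2 ≤ c ∧
    dist (γ • w.1) w'.1 ≤ c * Real.exp ((a + 1) * c) / w.2

theorem level_pos (t : Set.Ici (1 : ℝ)) : (0 : ℝ) < t := one_pos.trans_le t.2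

theorem WarpedClose.nonneg {a c : ℝ} {w w' : Y × Set.Ici (1 : ℝ)}
    (h : WarpedClose S a c w w') : 0 ≤ c := by
  obtain ⟨γ, h, -⟩ := h
  exact (Nat.cast_nonneg _).trans h

theorem WarpedClose.mono {a c c' : ℝ} (ha : 0 ≤ a) {w w' : Y × Set.Ici (1 : ℝ)}
    (h : WarpedClose S a c w w') (hc : c ≤ c') : WarpedClose S a c' w w' := by
  have hc0 := h.nonneg
  have := level_pos w.2
  obtain ⟨γ, h1, h2, h3⟩ := h
  refine ⟨γ, h1.trans hc, h2.trans hc, h3.trans ?_⟩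
  have : 0 ≤ c' := hc0.trans hc
  gcongr

/-- The exponent `(a + 1) * c` is made for this additivity: `a` pays for the expansion of the first
error by `γ'`, and `1` for replacing the level of `w'` by that of `w`. -/
theorem WarpedClose.trans (hS : Subgroup.closure (S : Set Γ) = ⊤) {a : ℝ} (ha : 0 ≤ a)
    (hLip : ∀ (γ : Γ) (x y : Y),
      dist (γ • x) (γ • y) ≤ Real.exp (a * wordLength S γ) * dist x y)
    {c c' : ℝ} {w w' w'' : Y × Set.Ici (1 : ℝ)} (h : WarpedClose S a c w w')
    (h' : WarpedClose S a c' w' w'') : WarpedClose S a (c + c') w w'' := by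
  have hc := h.nonneg
  have hc' := h'.nonneg
  have hw := level_pos w.2
  have hw' := level_pos w'.2
  obtain ⟨γ, h1, h2, h3⟩ := h
  obtain ⟨γ', h1', h2', h3'⟩ := h'
  refine ⟨γ' * γ, ?_, by linarith, ?_⟩
  · have : (wordLength S (γ' * γ) : ℝ) ≤ wordLength S γ' + wordLength S γ := by
      exact_mod_cast wordLength_mul_le hS γ' γ
    linarith
  · have hinv : (1 : ℝ) / w'.2 ≤ Real.exp c / w.2 := by
      rw [div_le_div_iff₀ hw' hw, one_mul]
      have := Real.exp_le_exp.mpr (show Real.log w.2 ≤ c + Real.log w'.2 by linarith)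
      rwa [Real.exp_add, Real.exp_log hw, Real.exp_log hw'] at this
    rw [mul_smul]
    calc dist (γ' • γ • w.1) w''.1
        ≤ dist (γ' • γ • w.1) (γ' • w'.1) + dist (γ' • w'.1) w''.1 := dist_triangle _ _ _
      _ ≤ Real.exp (a * c') * (c * Real.exp ((a + 1) * c) / w.2)
          + c' * Real.exp ((a + 1) * c') * (1 / w'.2) := by
        gcongr
        · refine (hLip _ _ _).trans ?_
          gcongr
        · rw [mul_one_div]; exact h3'
      _ ≤ Real.exp ((a + 1) * c') * (c * Real.exp ((a + 1) * c) / w.2)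
          + c' * Real.exp ((a + 1) * c') * (Real.exp ((a + 1) * c) / w.2) := by
        have : Real.exp c ≤ Real.exp ((a + 1) * c) :=
          Real.exp_le_exp.mpr (by nlinarith)
        refine add_le_add ?_ (mul_le_mul_of_nonneg_left (hinv.trans ?_) (by positivity))
        · gcongr
          linarith
        · gcongr
      _ = (c + c') * Real.exp ((a + 1) * (c + c')) / w.2 := by
        rw [mul_add (a + 1), Real.exp_add]
        ring

/-- The group element is `1`. As levels are at least 1, the difference of their logarithms is at
most the cone distance, so the exponential factor makes up for the minimum of the levels. -/
theorem warpedClose_coneDist {a : ℝ} (ha : 0 ≤ a) (w w' : Y × Set.Ici (1 : ℝ)) :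
    WarpedClose S a (coneDist w w') w w' := by
  have hw := level_pos w.2
  have hw' := level_pos w'.2
  have hm : 0 < min (w.2 : ℝ) w'.2 := lt_min hw hw'
  have hd : 0 ≤ min (w.2 : ℝ) w'.2 * dist w.1 w'.1 := by positivity
  have hlog : Real.log w.2 - Real.log w'.2 ≤ |(w.2 : ℝ) - w'.2| := by
    rw [← Real.log_div hw.ne' hw'.ne']
    have h1 := Real.log_le_sub_one_of_pos (div_pos hw hw')
    refine h1.trans ?_
    rw [div_sub_one hw'.ne', div_le_iff₀ hw']
    have h2 := le_abs_self ((w.2 : ℝ) - w'.2)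
    have h3 : (1 : ℝ) ≤ w'.2 := w'.2.2
    nlinarith [abs_nonneg ((w.2 : ℝ) - w'.2)]
  have hc : |(w.2 : ℝ) - w'.2| ≤ coneDist w w' := by rw [coneDist]; linarith
  have hc0 : 0 ≤ coneDist w w' := (abs_nonneg _).trans hc
  refine ⟨1, by simpa [wordLength_one] using hc0, hlog.trans hc, ?_⟩
  rw [one_smul, le_div_iff₀ hw]
  have hexp : (w.2 : ℝ) ≤ min (w.2 : ℝ) w'.2 * Real.exp ((a + 1) * coneDist w w') := by
    have h1 : Real.exp (coneDist w w') ≤ Real.exp ((a + 1) * coneDist w w') :=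
      Real.exp_le_exp.mpr (by nlinarith)
    have h2 : 1 ≤ Real.exp (coneDist w w') := Real.one_le_exp hc0
    rcases min_choice (w.2 : ℝ) w'.2 with h | h
    · rw [h]; nlinarith
    · rw [h]
      have := Real.exp_le_exp.mpr
        (show Real.log w.2 ≤ Real.log w'.2 + coneDist w w' by linarith)
      rw [Real.exp_add, Real.exp_log hw, Real.exp_log hw'] at this
      exact this.trans (by gcongr)
  calc dist w.1 w'.1 * w.2
      ≤ dist w.1 w'.1 * (min (w.2 : ℝ) w'.2 * Real.exp ((a + 1) * coneDist w w')) := by gcongr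
    _ = min (w.2 : ℝ) w'.2 * dist w.1 w'.1 * Real.exp ((a + 1) * coneDist w w') := by ring
    _ ≤ _ := by
      gcongr
      rw [coneDist]
      linarith [abs_nonneg ((w.2 : ℝ) - w'.2)]

theorem warpedClose_smul {a : ℝ} (γ : Γ) (w : Y × Set.Ici (1 : ℝ)) :
    WarpedClose S a (wordLength S γ) w (γ • w.1, w.2) := by
  have := level_pos w.2
  refine ⟨γ, le_rfl, by simp, ?_⟩
  rw [dist_self]
  positivity

/-- The infimum of the `c` for which `WarpedClose` holds in both directions is a pseudometric
obeying both defining bounds, hence it is at most the warped distance. -/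
theorem warpedClose_of_warpedDist_lt (hS : Subgroup.closure (S : Set Γ) = ⊤) {a : ℝ}
    (ha : 0 ≤ a)
    (hLip : ∀ (γ : Γ) (x y : Y),
      dist (γ • x) (γ • y) ≤ Real.exp (a * wordLength S γ) * dist x y)
    {R : ℝ} {w w' : Y × Set.Ici (1 : ℝ)} (h : warpedDist S w w' < R) :
    WarpedClose S a R w w' := by
  let C : Y × Set.Ici (1 : ℝ) → Y × Set.Ici (1 : ℝ) → Set ℝ := fun w w' =>
    {c | WarpedClose S a c w w' ∧ WarpedClose S a c w' w}
  have hbdd : ∀ w w', BddBelow (C w w') := fun w w' => ⟨0, fun c hc => hc.1.nonneg⟩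
  have hcone : ∀ w w', coneDist w w' ∈ C w w' := fun w w' => by
    refine ⟨warpedClose_coneDist ha w w', ?_⟩
    have : coneDist w w' = coneDist w' w := by
      simp only [coneDist, abs_sub_comm (w.2 : ℝ), dist_comm w.1, min_comm (w.2 : ℝ)]
    rw [this]
    exact warpedClose_coneDist ha w' w
  have hcomm : ∀ w w', C w w' = C w' w := fun w w' => Set.ext fun c => and_comm
  have key : sInf (C w w') ≤ warpedDist S w w' := by
    refine le_warpedDist (ρ := fun w w' => sInf (C w w')) hS ?_ ?_ ?_ ?_ ?_ w w'
    · intro w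
      refine le_antisymm ?_ (Real.sInf_nonneg fun c hc => hc.1.nonneg)
      exact (csInf_le (hbdd w w) (hcone w w)).trans (by simp [coneDist])
    · exact fun w w' => by rw [hcomm]
    · intro w w' w''
      refine le_of_forall_pos_lt_add fun ε hε => ?_
      obtain ⟨c, hc, hlt⟩ := exists_lt_of_csInf_lt ⟨_, hcone w w'⟩
        (show sInf (C w w') < sInf (C w w') + ε / 2 by linarith)
      obtain ⟨c', hc', hlt'⟩ := exists_lt_of_csInf_lt ⟨_, hcone w' w''⟩
        (show sInf (C w' w'') < sInf (C w' w'') + ε / 2 by linarith)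
      have hmem : c + c' ∈ C w w'' := ⟨hc.1.trans hS ha hLip hc'.1, by
        rw [add_comm]; exact hc'.2.trans hS ha hLip hc.2⟩
      linarith [csInf_le (hbdd w w'') hmem]
    · exact fun w w' => csInf_le (hbdd w w') (hcone w w')
    · intro γ w
      refine csInf_le (hbdd _ _) ⟨warpedClose_smul γ w, ?_⟩
      have h1 := warpedClose_smul (S := S) (a := a) γ⁻¹ (γ • w.1, w.2)
      simp only [inv_smul_smul] at h1
      exact h1.mono ha (by exact_mod_cast wordLength_inv_le hS γ)
  obtain ⟨c, hc, hlt⟩ := exists_lt_of_csInf_lt ⟨_, hcone w w'⟩ (key.trans_lt h)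
  exact hc.1.mono ha hlt.le

/-- A polynomial bound for the measure of small balls extends to all radii. -/
theorem exists_measureReal_ball_le [MeasurableSpace Y] (μ : Measure Y)
    [IsProbabilityMeasure μ] {k : ℝ} (hk : 0 < k)
    (hμ : (fun r : ℝ => ⨆ y : Y, μ.real (Metric.ball y r)) =O[𝓝[>] 0] (fun r : ℝ => r ^ k)) :
    ∃ C : ℝ, 0 < C ∧ ∀ (y : Y) (r : ℝ), 0 < r → μ.real (Metric.ball y r) ≤ C * r ^ k := by
  obtain ⟨c, hc⟩ := hμ.bound
  obtain ⟨r₀, hr₀, h⟩ := mem_nhdsGT_iff_exists_Ioo_subset.mp hc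
  have hr₀' : 0 < r₀ := hr₀
  refine ⟨max c (r₀ ^ k)⁻¹, lt_max_of_lt_right (by positivity), fun y r hr => ?_⟩
  have hrk : 0 < r ^ k := Real.rpow_pos_of_pos hr k
  rcases lt_or_ge r r₀ with hlt | hge
  · have h1 : ‖⨆ y : Y, μ.real (Metric.ball y r)‖ ≤ c * ‖r ^ k‖ := h ⟨hr, hlt⟩
    rw [Real.norm_of_nonneg hrk.le] at h1
    have h2 : μ.real (Metric.ball y r) ≤ ⨆ y : Y, μ.real (Metric.ball y r) :=
      le_ciSup (f := fun y : Y => μ.real (Metric.ball y r))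
        ⟨1, by rintro _ ⟨y, rfl⟩; exact measureReal_le_one⟩ y
    refine (h2.trans (le_abs_self _)).trans (h1.trans ?_)
    gcongr
    exact le_max_left _ _
  · refine measureReal_le_one.trans ?_
    calc (1 : ℝ) = (r₀ ^ k)⁻¹ * r₀ ^ k := by
          rw [inv_mul_cancel₀ (Real.rpow_pos_of_pos hr₀' k).ne']
      _ ≤ _ := by
        gcongr
        exact le_max_right _ _

/-- On the level `t`, a ball of radius `R` in the warped metric has measure at most
`C exp(β R) t ^ (-k)`. -/
theorem exists_measureReal_warped_ball_le [MeasurableSpace Y]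
    (μ : Measure Y) [IsProbabilityMeasure μ] (hS : Subgroup.closure (S : Set Γ) = ⊤) {k : ℝ}
    (hk : 0 < k) (hLip : ∀ γ : Γ, ∃ L : ℝ≥0, LipschitzWith L (fun y : Y => γ • y))
    (hμ : (fun r : ℝ => ⨆ y : Y, μ.real (Metric.ball y r)) =O[𝓝[>] 0] (fun r : ℝ => r ^ k)) :
    ∃ C β : ℝ, 0 < C ∧ 0 ≤ β ∧ ∀ (x : Y) (t : Set.Ici (1 : ℝ)) (R : ℝ), 0 < R →
      μ.real {y | warpedDist S (x, t) (y, t) < R} ≤ C * Real.exp (β * R) / (t : ℝ) ^ k := by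
  obtain ⟨a, ha, hLip⟩ := exists_dist_smul_le_exp_wordLength (Y := Y) hS hLip
  obtain ⟨C, hC, hball⟩ := exists_measureReal_ball_le μ hk hμ
  obtain ⟨N, hN, hcard⟩ := exists_finset_wordLength_le hS
  have hN' : (1 : ℝ) ≤ N := by exact_mod_cast hN
  have hlogN : 0 ≤ Real.log N := Real.log_nonneg hN'
  -- In the rate, `log N` counts the translates. The radius contributes `(a + 2) * k`, where `a + 1`
  -- becomes `a + 2` because `R ≤ exp R` absorbs the linear factor.
  refine ⟨C * 2 ^ k, Real.log N + (a + 2) * k, by positivity, by positivity,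
    fun x t R hR => ?_⟩
  have ht := level_pos t
  obtain ⟨B, hB, hmem⟩ := hcard ⌊R⌋₊
  set r := 2 * (R * Real.exp ((a + 1) * R) / t) with hr
  have hr0 : 0 < r := by positivity
  have hsub : {y | warpedDist S (x, t) (y, t) < R} ⊆ ⋃ γ ∈ B, Metric.ball (γ • x) r := by
    intro y hy
    obtain ⟨γ, h1, -, h3⟩ := warpedClose_of_warpedDist_lt hS ha hLip hy
    refine Set.mem_biUnion (hmem γ (Nat.le_floor h1)) ?_
    rw [Metric.mem_ball, dist_comm]
    exact h3.trans_lt (by rw [hr]; linarith [half_pos hr0])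
  have hrk : r ^ k ≤ 2 ^ k * Real.exp ((a + 2) * k * R) / (t : ℝ) ^ k := by
    calc r ^ k ≤ (2 * Real.exp ((a + 2) * R) / t) ^ k := by
          have h1 : R ≤ Real.exp R := by linarith [Real.add_one_le_exp R]
          have h2 : Real.exp ((a + 2) * R) = Real.exp R * Real.exp ((a + 1) * R) := by
            rw [← Real.exp_add]; ring_nf
          rw [hr, h2, ← mul_div_assoc]
          gcongr
      _ = _ := by
        rw [Real.div_rpow (by positivity) ht.le, Real.mul_rpow (by norm_num) (Real.exp_nonneg _),
          ← Real.exp_mul]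
        ring_nf
  have hBexp : (B.card : ℝ) ≤ Real.exp (Real.log N * R) := by
    calc (B.card : ℝ) ≤ (N : ℝ) ^ ⌊R⌋₊ := by exact_mod_cast hB
      _ = Real.exp (Real.log N * ⌊R⌋₊) := by
        rw [mul_comm, Real.exp_nat_mul, Real.exp_log (by linarith)]
      _ ≤ _ := by
        gcongr
        exact Nat.floor_le hR.le
  calc μ.real {y | warpedDist S (x, t) (y, t) < R}
      ≤ μ.real (⋃ γ ∈ B, Metric.ball (γ • x) r) := measureReal_mono hsub (measure_ne_top _ _)
    _ ≤ ∑ γ ∈ B, μ.real (Metric.ball (γ • x) r) := measureReal_biUnion_finset_le _ _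
    _ ≤ ∑ γ ∈ B, C * r ^ k := Finset.sum_le_sum fun γ _ => hball _ _ hr0
    _ = B.card * (C * r ^ k) := by simp
    _ ≤ Real.exp (Real.log N * R) *
        (C * (2 ^ k * Real.exp ((a + 2) * k * R) / (t : ℝ) ^ k)) := by gcongr
    _ = _ := by
      rw [add_mul (Real.log N), Real.exp_add]
      ring

end WarpedBall

/-! ### Concentration from the spectral gap -/

theorem exists_simpleFunc_mem {α ι : Type*} [MeasurableSpace α] [Nonempty ι] {A : ι → Set α}
    (hA : ∀ i, MeasurableSet (A i)) (T : Finset ι) :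
    ∃ g : SimpleFunc α ι, ∀ x, (∃ i ∈ T, x ∈ A i) → x ∈ A (g x) := by
  classical
  induction T using Finset.induction_on with
  | empty => exact ⟨SimpleFunc.const α (Classical.arbitrary ι), by simp⟩
  | insert a T _ ih =>
    obtain ⟨g, hg⟩ := ih
    refine ⟨SimpleFunc.piecewise (A a) (hA a) (SimpleFunc.const α a) g, fun x hx => ?_⟩
    by_cases hxa : x ∈ A a
    · simp [hxa]
    · obtain ⟨i, hi, hxi⟩ := hx
      rcases Finset.mem_insert.mp hi with rfl | hi
      · exact absurd hxi hxa
      · simpa [hxa] using hg x ⟨i, hi, hxi⟩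

/-- Under a spectral gap, a function with small displacements is close to a constant on a set of
measure at least `1 / 2`. -/
theorem exists_half_le_measureReal_of_spectralGap {Γ Y E : Type*} [Group Γ] [MulAction Γ Y]
    [MeasurableSpace Y] {S : Finset Γ} (μ : Measure Y) [IsProbabilityMeasure μ] {p : ℝ≥0∞}
    (hp : 1 < p) [NormedAddCommGroup E] [NormedSpace ℝ E] [CompleteSpace E] {κ : ℝ}
    (hκ : 0 < κ)
    (hgap : ∀ f : Y → E, MemLp f p μ → ∫ y, f y ∂μ = 0 →
      ENNReal.ofReal κ * eLpNorm f p μ ≤ ⨆ s ∈ S, eLpNorm (fun y => f y - f (s⁻¹ • y)) p μ)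
    (F : SimpleFunc Y E) {b : ℝ} (hb : 0 < b)
    (hF : ∀ s ∈ S, ∀ y, ‖F y - F (s⁻¹ • y)‖ ≤ b) :
    ∃ m : E, 1 / 2 ≤ μ.real {y | ‖F y - m‖ < 2 * b / κ} := by
  -- Around the mean, the gap gives `L_p` norm, hence `L_1` norm, at most `b / κ`; Markov's
  -- inequality at twice this value leaves measure at least `1/2`.
  refine ⟨∫ y, F y ∂μ, ?_⟩
  set m := ∫ y, F y ∂μ
  let G : SimpleFunc Y E := F - SimpleFunc.const Y m
  have hG : ∀ y, G y = F y - m := fun y => rfl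
  have hint : Integrable F μ := F.integrable_of_isFiniteMeasure
  have hG0 : ∫ y, G y ∂μ = 0 := by
    simp only [hG]
    rw [integral_sub hint (integrable_const _)]
    simp [m]
  have h1 := hgap G (G.memLp_of_isFiniteMeasure p μ) hG0
  have h2 : ⨆ s ∈ S, eLpNorm (fun y => G y - G (s⁻¹ • y)) p μ ≤ ENNReal.ofReal b := by
    refine iSup₂_le fun s hs => ?_
    refine (eLpNorm_le_of_ae_bound (C := b) (ae_of_all _ fun y => ?_)).trans (by simp)
    simpa [hG] using hF s hs y
  have h3 : ENNReal.ofReal κ * eLpNorm G 1 μ ≤ ENNReal.ofReal b :=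
    (mul_le_mul_right (eLpNorm_le_eLpNorm_of_exponent_le hp.le
      G.aestronglyMeasurable) _).trans (h1.trans h2)
  rw [eLpNorm_one_eq_lintegral_enorm] at h3
  have h4 : ENNReal.ofReal (2 * b / κ) * μ {y | ENNReal.ofReal (2 * b / κ) ≤ ‖G y‖ₑ} ≤
      ∫⁻ y, ‖G y‖ₑ ∂μ := mul_meas_ge_le_lintegral₀ G.aestronglyMeasurable.enorm _
  have hset : {y | ENNReal.ofReal (2 * b / κ) ≤ ‖G y‖ₑ} = {y | ‖F y - m‖ < 2 * b / κ}ᶜ := by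
    ext y
    simp only [Set.mem_ofPred_eq, Set.mem_compl_iff, not_lt, hG]
    rw [← ofReal_norm, ENNReal.ofReal_le_ofReal_iff (norm_nonneg _)]
  have hmeas : MeasurableSet {y | ‖F y - m‖ < 2 * b / κ} :=
    G.measurableSet_preimage {v | ‖v‖ < 2 * b / κ}
  rw [hset] at h4
  have h5 : ENNReal.ofReal κ * (ENNReal.ofReal (2 * b / κ) *
      μ {y | ‖F y - m‖ < 2 * b / κ}ᶜ) ≤ ENNReal.ofReal b :=
    (mul_le_mul_right h4 _).trans h3
  rw [← ENNReal.ofReal_toReal (measure_ne_top μ {y | ‖F y - m‖ < 2 * b / κ}ᶜ),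
    ← ENNReal.ofReal_mul (by positivity), ← ENNReal.ofReal_mul hκ.le,
    ENNReal.ofReal_le_ofReal_iff hb.le] at h5
  change κ * (2 * b / κ * μ.real _) ≤ b at h5
  rw [probReal_compl_eq_one_sub hmeas] at h5
  have h6 : κ * (2 * b / κ * (1 - μ.real {y | ‖F y - m‖ < 2 * b / κ})) =
    2 * b * (1 - μ.real {y | ‖F y - m‖ < 2 * b / κ}) := by field_simp
  rw [h6] at h5
  nlinarith

/-- The suprema in the distortion of a bi-Lipschitz map, as real constants. -/
theorem IsBiLipschitz.exists_mapDistortion_eq {X E : Type*} [MetricSpace X] [Nontrivial X]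
    [MetricSpace E] {f : X → E} (hf : IsBiLipschitz f) :
    ∃ L M : ℝ, 0 < L ∧ 0 < M ∧ 1 ≤ L * M ∧ mapDistortion f = ENNReal.ofReal (L * M) ∧
      (∀ x y, dist (f x) (f y) ≤ L * dist x y) ∧ ∀ x y, dist x y ≤ M * dist (f x) (f y) := by
  obtain ⟨K, hK, hK'⟩ := hf
  set l := ⨆ (x : X) (y : X) (_ : x ≠ y), edist (f x) (f y) / edist x y with hl
  set m := ⨆ (x : X) (y : X) (_ : x ≠ y), edist x y / edist (f x) (f y) with hm
  have hne : ∀ {x y : X}, x ≠ y → edist x y ≠ 0 := fun h => by simpa using h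
  have hne' : ∀ {x y : X}, x ≠ y → edist (f x) (f y) ≠ 0 := fun h => by
    simpa using hK'.injective.ne h
  have hl1 : ∀ {x y : X}, x ≠ y → edist (f x) (f y) / edist x y ≤ l := fun {x y} h =>
    le_iSup_of_le x (le_iSup_of_le y (le_iSup_of_le h le_rfl))
  have hm1 : ∀ {x y : X}, x ≠ y → edist x y / edist (f x) (f y) ≤ m := fun {x y} h =>
    le_iSup_of_le x (le_iSup_of_le y (le_iSup_of_le h le_rfl))
  have hlt : l ≠ ∞ := ne_top_of_le_ne_top ENNReal.coe_ne_top
    (iSup_le fun x => iSup_le fun y => iSup_le fun _ => ENNReal.div_le_of_le_mul (hK x y))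
  have hmt : m ≠ ∞ := ne_top_of_le_ne_top ENNReal.coe_ne_top
    (iSup_le fun x => iSup_le fun y => iSup_le fun _ => ENNReal.div_le_of_le_mul (hK' x y))
  have hL : ∀ x y, edist (f x) (f y) ≤ l * edist x y := fun x y => by
    rcases eq_or_ne x y with rfl | h
    · simp
    · exact (ENNReal.div_le_iff (hne h) (edist_ne_top _ _)).mp (hl1 h)
  have hM : ∀ x y, edist x y ≤ m * edist (f x) (f y) := fun x y => by
    rcases eq_or_ne x y with rfl | h
    · simp
    · exact (ENNReal.div_le_iff (hne' h) (edist_ne_top _ _)).mp (hm1 h)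
  have hL' : ∀ x y, dist (f x) (f y) ≤ l.toReal * dist x y := fun x y => by
    rw [dist_edist, dist_edist, ← ENNReal.toReal_mul]
    exact ENNReal.toReal_mono (ENNReal.mul_ne_top hlt (edist_ne_top _ _)) (hL x y)
  have hM' : ∀ x y, dist x y ≤ m.toReal * dist (f x) (f y) := fun x y => by
    rw [dist_edist, dist_edist, ← ENNReal.toReal_mul]
    exact ENNReal.toReal_mono (ENNReal.mul_ne_top hmt (edist_ne_top _ _)) (hM x y)
  obtain ⟨x, y, hxy⟩ := exists_pair_ne X
  have hd : 0 < dist x y := dist_pos.mpr hxy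
  have hfd : 0 < dist (f x) (f y) := dist_pos.mpr (hK'.injective.ne hxy)
  have hl0 : 0 < l.toReal := pos_of_mul_pos_left (hfd.trans_le (hL' x y)) hd.le
  have hm0 : 0 < m.toReal := pos_of_mul_pos_left (hd.trans_le (hM' x y)) hfd.le
  refine ⟨l.toReal, m.toReal, hl0, hm0, ?_, ?_, hL', hM'⟩
  · have h1 : dist x y ≤ m.toReal * (l.toReal * dist x y) :=
      (hM' x y).trans (mul_le_mul_of_nonneg_left (hL' x y) hm0.le)
    by_contra h
    nlinarith [not_le.mp h]
  · rw [← ENNReal.toReal_mul, ENNReal.ofReal_toReal (ENNReal.mul_ne_top hlt hmt)]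
    rfl

/-! ### The logarithmic lower bound -/

section LowerBound

variable {Γ Y : Type*} [Group Γ] [MetricSpace Y] [MulAction Γ Y] {S : Finset Γ}

theorem WarpedCone.dist_level_le (hS : Subgroup.closure (S : Set Γ) = ⊤) (t : Set.Ici (1 : ℝ))
    (x y : Y) : dist (show WarpedCone Y S hS from (x, t)) (show WarpedCone Y S hS from (y, t)) ≤
      t * dist x y := by
  have := (isGreatest_warpedDist (Y := Y) hS).1.le_coneDist (x, t) (y, t)
  exact this.trans_eq (by simp [coneDist])

theorem WarpedCone.dist_smul_le (hS : Subgroup.closure (S : Set Γ) = ⊤) (t : Set.Ici (1 : ℝ))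
    (γ : Γ) (y : Y) : dist (show WarpedCone Y S hS from (y, t))
      (show WarpedCone Y S hS from (γ • y, t)) ≤ wordLength S γ :=
  (isGreatest_warpedDist (Y := Y) hS).1.le_wordLength γ (y, t)

/-- A measurable choice of nearby points of a finite net. -/
theorem exists_simpleFunc_dist_le [MeasurableSpace Y] [BorelSpace Y] [Nonempty Y]
    {hS : Subgroup.closure (S : Set Γ) = ⊤} {t : Set.Ici (1 : ℝ)} {Z : Set (WarpedCone Y S hS)}
    (hfin : Z.Finite) (hZ : IsNet dist 1 (WarpedCone.level t) Z) :
    ∃ z : SimpleFunc Y Z, ∀ y, dist (z y : WarpedCone Y S hS) (y, t) ≤ 1 := by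
  have := hfin.fintype
  obtain ⟨y₀⟩ := ‹Nonempty Y›
  have hex : ∀ y : Y, ∃ z : Z, dist (z : WarpedCone Y S hS) (y, t) ≤ 1 := fun y => by
    obtain ⟨z, hz, h⟩ := hZ.2 (y, t) rfl
    exact ⟨⟨z, hz⟩, h⟩
  have : Nonempty Z := ⟨(hex y₀).choose⟩
  have hcont : Continuous fun y : Y => (show WarpedCone Y S hS from (y, t)) :=
    (LipschitzWith.of_dist_le_mul (K := ⟨t, (level_pos t).le⟩)
      fun x y => WarpedCone.dist_level_le hS t x y).continuous
  obtain ⟨g, hg⟩ := exists_simpleFunc_mem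
    (A := fun z : Z => {y : Y | dist (z : WarpedCone Y S hS) (y, t) ≤ 1})
    (fun z => (isClosed_le (continuous_const.dist hcont) continuous_const).measurableSet)
    Finset.univ
  exact ⟨g, fun y => hg y ((hex y).imp fun z hz => ⟨Finset.mem_univ _, hz⟩)⟩

/-- Two points whose images are within `6L/κ` of the mean have net points at distance at most
`12LM/κ`. Passing to the net costs 2 more, and `3` leaves room for the strict inequality. -/
theorem half_le_measureReal_warped_ball [MeasurableSpace Y] [BorelSpace Y] (μ : Measure Y)
    [IsProbabilityMeasure μ] {E : Type*} [NormedAddCommGroup E] [NormedSpace ℝ E]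
    [CompleteSpace E] {p : ℝ≥0∞} (hp : 1 < p) {κ : ℝ} (hκ : 0 < κ)
    (hgap : ∀ f : Y → E, MemLp f p μ → ∫ y, f y ∂μ = 0 →
      ENNReal.ofReal κ * eLpNorm f p μ ≤ ⨆ s ∈ S, eLpNorm (fun y => f y - f (s⁻¹ • y)) p μ)
    {hS : Subgroup.closure (S : Set Γ) = ⊤} {t : Set.Ici (1 : ℝ)} {Z : Set (WarpedCone Y S hS)}
    (hfin : Z.Finite) (hZ : IsNet dist 1 (WarpedCone.level t) Z) {f : Z → E} {L M : ℝ}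
    (hL : 0 < L) (hM : 0 < M) (hfL : ∀ x y, dist (f x) (f y) ≤ L * dist x y)
    (hfM : ∀ x y, dist x y ≤ M * dist (f x) (f y)) :
    ∃ x : Y, 1 / 2 ≤ μ.real {y | warpedDist S (x, t) (y, t) < 12 / κ * (L * M) + 3} := by
  have : Nonempty Y := μ.nonempty_of_neZero
  obtain ⟨z, hz⟩ := exists_simpleFunc_dist_le hfin hZ
  have hz' : ∀ y, dist (show WarpedCone Y S hS from (y, t)) (z y) ≤ 1 := fun y => by
    rw [dist_comm]; exact hz y
  obtain ⟨m, hm⟩ := exists_half_le_measureReal_of_spectralGap μ hp hκ hgap (z.map f)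
    (b := 3 * L) (by positivity) fun s hs y => by
      rw [SimpleFunc.map_apply, SimpleFunc.map_apply, ← dist_eq_norm]
      refine (hfL _ _).trans ?_
      have h1 : dist (z y : WarpedCone Y S hS) (z (s⁻¹ • y)) ≤ 3 := by
        have h2 := dist_triangle4 (z y : WarpedCone Y S hS) (y, t) (s⁻¹ • y, t) (z (s⁻¹ • y))
        have h3 := WarpedCone.dist_smul_le hS t s⁻¹ y
        have h4 : (wordLength S s⁻¹ : ℝ) ≤ 1 := by exact_mod_cast wordLength_inv_le_one hs
        linarith [hz y, hz' (s⁻¹ • y)]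
      rw [Subtype.dist_eq]
      nlinarith
  obtain ⟨x, hx⟩ : {y | ‖z.map f y - m‖ < 2 * (3 * L) / κ}.Nonempty := by
    by_contra h
    rw [Set.not_nonempty_iff_eq_empty] at h
    rw [h] at hm
    norm_num at hm
  refine ⟨x, hm.trans (measureReal_mono (fun y hy => ?_) (measure_ne_top _ _))⟩
  rw [Set.mem_ofPred_eq, SimpleFunc.map_apply, ← dist_eq_norm] at hx hy
  have h1 : dist (f (z x)) (f (z y)) ≤ 12 * L / κ := by
    have := dist_triangle_right (f (z x)) (f (z y)) m
    have h2 : 12 * L / κ = 2 * (3 * L) / κ + 2 * (3 * L) / κ := by ring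
    linarith
  have h2 : dist (z x : WarpedCone Y S hS) (z y) ≤ 12 / κ * (L * M) := by
    have := (hfM (z x) (z y)).trans (mul_le_mul_of_nonneg_left h1 hM.le)
    rw [Subtype.dist_eq] at this
    exact this.trans_eq (by ring)
  have h3 := dist_triangle4 (show WarpedCone Y S hS from (x, t)) (z x) (z y) (y, t)
  change dist (show WarpedCone Y S hS from (x, t)) (show WarpedCone Y S hS from (y, t)) < _
  linarith [hz' x, hz y]

/-- The logarithmic lower bound for the distortion of nets of the levels. -/
theorem exists_log_le_distortion [MeasurableSpace Y] [BorelSpace Y] (μ : Measure Y)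
    [IsProbabilityMeasure μ] (hS : Subgroup.closure (S : Set Γ) = ⊤) (n : ℕ) {k : ℝ}
    (hk : 0 < k) (hLip : ∀ γ : Γ, ∃ L : ℝ≥0, LipschitzWith L (fun y : Y => γ • y))
    (hμ : (fun r : ℝ => ⨆ y : Y, μ.real (Metric.ball y r)) =O[𝓝[>] 0] (fun r : ℝ => r ^ k))
    (E : Type*) [NormedAddCommGroup E] [NormedSpace ℝ E] [CompleteSpace E] {p : ℝ≥0∞}
    (hp : 1 < p) (hgap : HasSpectralGap S μ p E) (A : ℝ) :
    ∃ c : ℝ, 0 < c ∧ ∀ (t : Set.Ici (1 : ℝ)) (Z : Set (WarpedCone Y S hS)),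
      Z.Finite → IsNet dist 1 (WarpedCone.level t) Z → (Z.ncard : ℝ) ≤ A * (t : ℝ) ^ n →
      ENNReal.ofReal (c * Real.log Z.ncard) ≤ distortion E Z := by
  obtain ⟨κ, hκ, hgap⟩ := hgap
  obtain ⟨C, β, hC, hβ, hball⟩ := exists_measureReal_warped_ball_le μ hS hk hLip hμ
  -- All additive constants are made nonnegative so that `1 ≤ L * M` turns them into multiples of `L
  -- * M`.
  set a₀ := |Real.log (2 * C)| + β * 3 with ha₀
  set a₁ := a₀ + β * (12 / κ) with ha₁
  have ha₀' : 0 ≤ a₀ := by positivity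
  have ha₁' : 0 ≤ a₁ := by positivity
  set d := |Real.log A| + n * (a₁ / k) + 1 with hd
  have hd0 : 0 < d := by positivity
  refine ⟨d⁻¹, by positivity, fun t Z hfin hZ hcard => ?_⟩
  have ht := level_pos t
  rcases Set.subsingleton_or_nontrivial Z with hsub | hnt
  · have := hfin.to_subtype
    have : Real.log Z.ncard = 0 := by
      have h1 : Z.ncard ≤ 1 := Set.ncard_le_one_iff_subsingleton.mpr hsub
      interval_cases Z.ncard <;> simp
    simp [this]
  have : Nontrivial Z := hnt.coe_sort
  refine le_iInf₂ fun f hf => ?_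
  obtain ⟨L, M, hL, hM, hLM, hD, hfL, hfM⟩ := hf.exists_mapDistortion_eq
  rw [hD]
  refine ENNReal.ofReal_le_ofReal ?_
  obtain ⟨x, hx⟩ := half_le_measureReal_warped_ball μ hp hκ hgap hfin hZ hL hM hfL hfM
  have h1 := hx.trans (hball x t (12 / κ * (L * M) + 3) (by positivity))
  have htk : 0 < (t : ℝ) ^ k := Real.rpow_pos_of_pos ht k
  have h2 : (t : ℝ) ^ k ≤ 2 * C * Real.exp (β * (12 / κ * (L * M) + 3)) := by
    rw [div_le_div_iff₀ two_pos htk] at h1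
    linarith
  have h3 := Real.log_le_log htk h2
  rw [Real.log_rpow ht, Real.log_mul (by positivity) (Real.exp_ne_zero _), Real.log_exp] at h3
  have h4 : Real.log t ≤ a₁ / k * (L * M) := by
    rw [div_mul_eq_mul_div, le_div_iff₀ hk]
    have := le_abs_self (Real.log (2 * C))
    nlinarith [mul_le_mul_of_nonneg_left hLM ha₀']
  have hZ0 : 0 < (Z.ncard : ℝ) := by
    exact_mod_cast (Set.ncard_pos hfin).mpr hnt.nonempty
  -- Positivity of `A` is forced by the existence of a nonempty net.
  have hA : 0 < A := pos_of_mul_pos_left (hZ0.trans_le hcard) (by positivity)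
  have h5 := Real.log_le_log hZ0 hcard
  rw [Real.log_mul hA.ne' (by positivity), Real.log_pow] at h5
  rw [inv_mul_le_iff₀ hd0]
  have h6 : (n : ℝ) * Real.log t ≤ n * (a₁ / k) * (L * M) := by
    rw [mul_assoc]; gcongr
  have h7 : Real.log A ≤ |Real.log A| * (L * M) :=
    (le_abs_self _).trans (le_mul_of_one_le_right (abs_nonneg _) hLM)
  rw [hd, add_mul, add_mul]
  linarith

end LowerBound

/-! ### Euclidean volume comparison for coverings and packings -/

section Volume

variable {n : ℕ}

theorem EuclideanSpace.volume_ball_eq (x : EuclideanSpace ℝ (Fin n)) {r : ℝ} (hr : 0 < r) :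
    volume (Metric.ball x r) =
      ENNReal.ofReal (r ^ n) * volume (Metric.ball (0 : EuclideanSpace ℝ (Fin n)) 1) := by
  rw [Measure.addHaar_ball_of_pos volume x hr, finrank_euclideanSpace, Fintype.card_fin]

theorem EuclideanSpace.pow_le_card_mul_of_ball_subset {ι : Type*} (N : Finset ι)
    (f : ι → EuclideanSpace ℝ (Fin n)) {c : EuclideanSpace ℝ (Fin n)} {ρ r : ℝ} (hρ : 0 < ρ)
    (hr : 0 < r) (hsub : Metric.ball c ρ ⊆ ⋃ i ∈ N, Metric.ball (f i) r) :
    ρ ^ n ≤ N.card * r ^ n := by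
  have hv0 : volume (Metric.ball (0 : EuclideanSpace ℝ (Fin n)) 1) ≠ 0 :=
    (Metric.measure_ball_pos volume _ one_pos).ne'
  have h := (measure_mono hsub).trans (measure_biUnion_finset_le (μ := volume) N _)
  simp only [EuclideanSpace.volume_ball_eq _ hr, EuclideanSpace.volume_ball_eq _ hρ,
    Finset.sum_const, nsmul_eq_mul] at h
  rw [← mul_assoc, ENNReal.mul_le_mul_iff_left hv0 measure_ball_lt_top.ne,
    ← ENNReal.ofReal_natCast, ← ENNReal.ofReal_mul (by positivity),
    ENNReal.ofReal_le_ofReal_iff (by positivity)] at h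
  exact h

theorem EuclideanSpace.card_mul_le_pow_of_separated {ι : Type*} (N : Finset ι)
    (f : ι → EuclideanSpace ℝ (Fin n)) {c : EuclideanSpace ℝ (Fin n)} {ρ r : ℝ} (hρ : 0 ≤ ρ)
    (hr : 0 < r) (hsub : ∀ i ∈ N, dist (f i) c ≤ ρ)
    (hsep : ∀ i ∈ N, ∀ j ∈ N, i ≠ j → 2 * r ≤ dist (f i) (f j)) :
    N.card * r ^ n ≤ (ρ + r) ^ n := by
  have hv0 : volume (Metric.ball (0 : EuclideanSpace ℝ (Fin n)) 1) ≠ 0 :=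
    (Metric.measure_ball_pos volume _ one_pos).ne'
  have hdisj : (N : Set ι).PairwiseDisjoint fun i => Metric.ball (f i) r :=
    fun i hi j hj hij => Metric.ball_disjoint_ball (by linarith [hsep i hi j hj hij])
  have hincl : ⋃ i ∈ N, Metric.ball (f i) r ⊆ Metric.ball c (ρ + r) :=
    Set.iUnion₂_subset fun i hi => Metric.ball_subset_ball' (by linarith [hsub i hi])
  have h := measure_mono (μ := volume) hincl
  rw [measure_biUnion_finset hdisj fun i _ => measurableSet_ball] at h
  simp only [EuclideanSpace.volume_ball_eq _ hr, EuclideanSpace.volume_ball_eq _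
    (add_pos_of_nonneg_of_pos hρ hr), Finset.sum_const, nsmul_eq_mul] at h
  rw [← mul_assoc, ENNReal.mul_le_mul_iff_left hv0 measure_ball_lt_top.ne,
    ← ENNReal.ofReal_natCast, ← ENNReal.ofReal_mul (by positivity),
    ENNReal.ofReal_le_ofReal_iff (by positivity)] at h
  exact h

end Volume

/-! ### Nets of the levels -/

section Nets

variable {n : ℕ} {Y : Type*} [MetricSpace Y]

theorem IsMetricManifold.exists_le_card_of_cover [Nonempty Y] (hY : IsMetricManifold n Y) :
    ∃ a : ℝ, 0 < a ∧ ∀ t : ℝ, 1 ≤ t → ∀ N : Finset Y,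
      (∀ y, ∃ x ∈ N, dist x y ≤ 1 / t) → a * t ^ n ≤ N.card := by
  classical
  obtain ⟨y₀⟩ := ‹Nonempty Y›
  obtain ⟨e, hy₀, K, hK, -⟩ := hY y₀
  obtain ⟨ρ, hρ, hball⟩ := Metric.isOpen_iff.mp e.open_target (e y₀) (e.map_source hy₀)
  have hK0 : (0 : ℝ) ≤ K := K.coe_nonneg
  refine ⟨(ρ / (2 * K + 1)) ^ n, by positivity, fun t ht N hN => ?_⟩
  have ht0 : 0 < t := by linarith
  -- A net point may lie outside the chart, so it is replaced by a chart point within `1 / t`; this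
  -- doubles the covering radius.
  let f : Y → EuclideanSpace ℝ (Fin n) := fun x =>
    if h : ∃ z ∈ e.source, dist x z ≤ 1 / t then e h.choose else 0
  have hsub : Metric.ball (e y₀) ρ ⊆ ⋃ x ∈ N, Metric.ball (f x) ((2 * K + 1) / t) := by
    intro v hv
    have hv' := hball hv
    obtain ⟨x, hx, hd⟩ := hN (e.symm v)
    have hex : ∃ z ∈ e.source, dist x z ≤ 1 / t := ⟨_, e.map_target hv', hd⟩
    refine Set.mem_biUnion hx ?_
    have hf : f x = e hex.choose := dif_pos hex
    rw [Metric.mem_ball, hf, ← e.right_inv hv']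
    refine (hK.dist_le_mul _ (e.map_target hv') _ hex.choose_spec.1).trans_lt ?_
    have h1 := dist_triangle_left (e.symm v) hex.choose x
    have h2 := hex.choose_spec.2
    calc (K : ℝ) * dist (e.symm v) hex.choose ≤ K * (1 / t + 1 / t) := by
          gcongr
          linarith
      _ = 2 * K / t := by ring
      _ < (2 * K + 1) / t := by gcongr; linarith
  have h := EuclideanSpace.pow_le_card_mul_of_ball_subset N f hρ (by positivity) hsub
  rw [div_pow, mul_div_assoc', le_div_iff₀ (by positivity)] at h
  rw [div_pow, div_mul_eq_mul_div, div_le_iff₀ (by positivity)]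
  exact h

/-- By compactness finitely many charts suffice. In each, the points stay separated at scale `1 / t`
up to a constant, inside a ball of fixed radius because the diameter is at most 1, so packing
applies. -/
theorem IsMetricManifold.exists_card_le_of_separated [CompactSpace Y]
    (hdiam : ∀ x y : Y, dist x y ≤ 1) (hY : IsMetricManifold n Y) :
    ∃ b : ℝ, 0 < b ∧ ∀ t : ℝ, 1 ≤ t → ∀ N : Finset Y,
      (∀ x ∈ N, ∀ y ∈ N, x ≠ y → 1 / t ≤ dist x y) → (N.card : ℝ) ≤ b * t ^ n := by
  classical
  choose e hmem K hK hK' using hY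
  obtain ⟨T, -, hT⟩ := isCompact_univ.elim_nhds_subcover (fun y => (e y).source)
    fun y _ => (e y).open_source.mem_nhds (hmem y)
  let b : Y → ℝ := fun y => (2 * (K y + 1) ^ 2 + 1) ^ n
  have hb : ∀ y, 0 ≤ b y := fun y => by positivity
  refine ⟨∑ y ∈ T, b y + 1, by positivity [Finset.sum_nonneg fun y (_ : y ∈ T) => hb y],
    fun t ht N hN => ?_⟩
  have ht0 : 0 < t := by linarith
  have hchart : ∀ y, ((N.filter (· ∈ (e y).source)).card : ℝ) ≤ b y * t ^ n := fun y => by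
    set k : ℝ := K y + 1 with hk
    have hk0 : 0 < k := by positivity
    have h := EuclideanSpace.card_mul_le_pow_of_separated (N.filter (· ∈ (e y).source)) (e y)
      (c := e y y) (ρ := k) (r := 1 / (2 * k * t)) (by positivity) (by positivity)
      (fun x hx => by
        refine ((hK y).dist_le_mul x (Finset.mem_filter.mp hx).2 y (hmem y)).trans ?_
        have := hdiam x y
        have h2 : (0 : ℝ) ≤ K y := (K y).coe_nonneg
        nlinarith)
      (fun x hx x' hx' hne => by
        obtain ⟨hxN, hxs⟩ := Finset.mem_filter.mp hx
        obtain ⟨hxN', hxs'⟩ := Finset.mem_filter.mp hx'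
        have h1 := (hK' y).dist_le_mul _ ((e y).map_source hxs) _ ((e y).map_source hxs')
        rw [(e y).left_inv hxs, (e y).left_inv hxs'] at h1
        have h2 := hN x hxN x' hxN' hne
        have h3 : 1 / t ≤ k * dist (e y x) (e y x') := by
          rw [hk, add_mul]
          linarith [dist_nonneg (x := e y x) (y := e y x')]
        have h4 : 2 * (1 / (2 * k * t)) = 1 / t / k := by field_simp
        rw [h4, div_le_iff₀ hk0]
        linarith)
    rw [div_pow, one_pow, mul_one_div, div_le_iff₀ (by positivity), ← mul_pow] at h
    refine h.trans ?_
    rw [← mul_pow]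
    refine pow_le_pow_left₀ (by positivity) ?_ n
    have h5 : (k + 1 / (2 * k * t)) * (2 * k * t) = 2 * k ^ 2 * t + 1 := by field_simp
    rw [h5]
    linarith
  have hcover : N ⊆ T.biUnion fun y => N.filter (· ∈ (e y).source) := fun x hx => by
    obtain ⟨y, hy, hxy⟩ := Set.mem_iUnion₂.mp (hT (Set.mem_univ x))
    exact Finset.mem_biUnion.mpr ⟨y, hy, Finset.mem_filter.mpr ⟨hx, hxy⟩⟩
  calc (N.card : ℝ) ≤ ∑ y ∈ T, ((N.filter (· ∈ (e y).source)).card : ℝ) := by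
        exact_mod_cast (Finset.card_le_card hcover).trans Finset.card_biUnion_le
    _ ≤ ∑ y ∈ T, b y * t ^ n := Finset.sum_le_sum fun y _ => hchart y
    _ ≤ (∑ y ∈ T, b y + 1) * t ^ n := by
        rw [← Finset.sum_mul, add_mul]
        linarith [pow_pos ht0 n]

/-- At the scale `1 / t`, there is a finite net whose cardinality is of order `t ^ n`. -/
theorem IsMetricManifold.exists_net [CompactSpace Y] [Nonempty Y]
    (hdiam : ∀ x y : Y, dist x y ≤ 1) (hY : IsMetricManifold n Y) :
    ∃ a b : ℝ, 0 < a ∧ 0 < b ∧ ∀ t : ℝ, 1 ≤ t → ∃ N : Finset Y,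
      (∀ y, ∃ x ∈ N, dist x y ≤ 1 / t) ∧ a * t ^ n ≤ N.card ∧ (N.card : ℝ) ≤ b * t ^ n := by
  classical
  obtain ⟨a, ha, hlow⟩ := hY.exists_le_card_of_cover
  obtain ⟨b, hb, hup⟩ := hY.exists_card_le_of_separated hdiam
  refine ⟨a, b, ha, hb, fun t ht => ?_⟩
  -- A separated set of largest cardinality is a net, since an uncovered point could be added to it.
  let C : Set ℕ := {k | ∃ N : Finset Y,
    (∀ x ∈ N, ∀ y ∈ N, x ≠ y → 1 / t ≤ dist x y) ∧ N.card = k}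
  have hbdd : BddAbove C := ⟨⌊b * t ^ n⌋₊, by
    rintro _ ⟨N, hN, rfl⟩
    exact Nat.le_floor (hup t ht N hN)⟩
  obtain ⟨N, hN, hcard⟩ := Nat.sSup_mem (s := C) ⟨0, ∅, by simp⟩ hbdd
  have hcover : ∀ y, ∃ x ∈ N, dist x y ≤ 1 / t := fun y => by
    by_contra! h
    have hyN : y ∉ N := fun hy => by
      have := h y hy
      rw [dist_self] at this
      exact absurd this (not_lt.mpr (by positivity))
    have hmem : (insert y N).card ∈ C := by
      refine ⟨insert y N, fun x hx x' hx' hne => ?_, rfl⟩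
      rcases Finset.mem_insert.mp hx with rfl | hxN <;>
        rcases Finset.mem_insert.mp hx' with rfl | hxN'
      · exact absurd rfl hne
      · rw [dist_comm]; exact (h x' hxN').le
      · exact (h x hxN).le
      · exact hN x hxN x' hxN' hne
    have := le_csSup hbdd hmem
    rw [Finset.card_insert_of_notMem hyN] at this
    omega
  exact ⟨N, hcover, hlow t ht N hcover, hup t ht N hN⟩

theorem exists_net_level [CompactSpace Y] [Nonempty Y] {Γ : Type*} [Group Γ] [MulAction Γ Y]
    (S : Finset Γ) (hS : Subgroup.closure (S : Set Γ) = ⊤)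
    (hdiam : ∀ x y : Y, dist x y ≤ 1) (hY : IsMetricManifold n Y) :
    ∃ a b : ℝ, 0 < a ∧ 0 < b ∧ ∀ t : Set.Ici (1 : ℝ), ∃ Z : Set (WarpedCone Y S hS),
      Z.Finite ∧ IsNet (X := WarpedCone Y S hS) coneDist 1 (WarpedCone.level t) Z ∧
      IsNet dist 1 (WarpedCone.level t) Z ∧
      a * (t : ℝ) ^ n ≤ Z.ncard ∧ (Z.ncard : ℝ) ≤ b * (t : ℝ) ^ n := by
  obtain ⟨a, b, ha, hb, h⟩ := hY.exists_net hdiam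
  refine ⟨a, b, ha, hb, fun t => ?_⟩
  have ht := level_pos t
  obtain ⟨N, hN, hlow, hup⟩ := h t t.2
  let i : Y → WarpedCone Y S hS := fun y => (y, t)
  have hi : Function.Injective i := fun x y hxy => congrArg Prod.fst hxy
  have hcard : (i '' (N : Set Y)).ncard = N.card := by
    rw [Set.ncard_image_of_injective _ hi, Set.ncard_coe_finset]
  have hnet : IsNet (X := WarpedCone Y S hS) coneDist 1 (WarpedCone.level t)
      (i '' (N : Set Y)) := by
    refine ⟨by rintro _ ⟨y, -, rfl⟩; rfl, ?_⟩
    rintro ⟨y, s⟩ hs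
    obtain rfl : s = t := hs
    obtain ⟨x, hx, hxy⟩ := hN y
    refine ⟨i x, ⟨x, hx, rfl⟩, ?_⟩
    rw [le_div_iff₀ ht] at hxy
    simpa [coneDist, i, mul_comm] using hxy
  refine ⟨i '' (N : Set Y), N.finite_toSet.image i, hnet, ⟨hnet.1, fun w hw => ?_⟩,
    by rwa [hcard], by rwa [hcard]⟩
  obtain ⟨z, hz, hle⟩ := hnet.2 w hw
  exact ⟨z, hz, ((isGreatest_warpedDist (Y := Y) hS).1.le_coneDist z w).trans hle⟩

end Nets

/-! ### Assembly of the three statements -/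

/-- `C` is the universal constant of the logarithmic upper bound for the Euclidean distortion;
`a`, `b` and `c` do not depend on the level `t` and the net `Z`. -/
theorem mainTheorem3 :
    ∃ C : ℝ, 0 < C ∧
    ∀ (Y : Type*) [MetricSpace Y] [CompactSpace Y] [MeasurableSpace Y] [BorelSpace Y]
      (μ : Measure Y) [IsProbabilityMeasure μ]
      (Γ : Type*) [Group Γ] [MulAction Γ Y]
      (S : Finset Γ) (hS : Subgroup.closure (S : Set Γ) = ⊤)
      (n : ℕ) (k : ℝ),
      (∀ x y : Y, dist x y ≤ 1) →
      IsMetricManifold n Y →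
      (∀ γ : Γ, MeasurePreserving (fun y : Y => γ • y) μ μ) →
      (∀ γ : Γ, ∃ L : ℝ≥0, LipschitzWith L (fun y : Y => γ • y)) →
      0 < k →
      (fun r : ℝ => ⨆ y : Y, μ.real (Metric.ball y r)) =O[𝓝[>] 0] (fun r : ℝ => r ^ k) →
      -- existence of 1-nets of the levels with cardinality of order `t ^ n`
      (∃ a b : ℝ, 0 < a ∧ 0 < b ∧ ∀ t : Set.Ici (1 : ℝ), ∃ Z : Set (WarpedCone Y S hS),
        Z.Finite ∧ IsNet (X := WarpedCone Y S hS) coneDist 1 (WarpedCone.level t) Z ∧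
        IsNet dist 1 (WarpedCone.level t) Z ∧
        a * (t : ℝ) ^ n ≤ Z.ncard ∧ (Z.ncard : ℝ) ≤ b * (t : ℝ) ^ n) ∧
      -- the lower bound for the distortion of all such nets
      (∀ (E : Type*) [NormedAddCommGroup E] [NormedSpace ℝ E] [CompleteSpace E]
        (p : ℝ≥0∞), 1 < p → p ≠ ∞ → HasSpectralGap S μ p E →
        ∀ A : ℝ, ∃ c : ℝ, 0 < c ∧ ∀ (t : Set.Ici (1 : ℝ)) (Z : Set (WarpedCone Y S hS)),
          Z.Finite → IsNet dist 1 (WarpedCone.level t) Z → (Z.ncard : ℝ) ≤ A * (t : ℝ) ^ n →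
          ENNReal.ofReal (c * Real.log Z.ncard) ≤ distortion E Z) ∧
      -- the Euclidean case
      (∀ p : ℝ≥0∞, 1 < p → p ≠ ∞ → HasSpectralGap S μ p (lp (fun _ : ℕ => ℝ) 2) →
        ∀ A : ℝ, ∃ c : ℝ, 0 < c ∧ ∀ (t : Set.Ici (1 : ℝ)) (Z : Set (WarpedCone Y S hS)),
          Z.Finite → IsNet dist 1 (WarpedCone.level t) Z → (Z.ncard : ℝ) ≤ A * (t : ℝ) ^ n →
          ENNReal.ofReal (c * Real.log Z.ncard) ≤ distortion (lp (fun _ : ℕ => ℝ) 2) Z ∧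
          distortion (lp (fun _ : ℕ => ℝ) 2) Z ≤ ENNReal.ofReal (C * Real.log Z.ncard)) := by
  refine ⟨48 / Real.log 2, div_pos (by norm_num) (Real.log_pos one_lt_two), ?_⟩
  intro Y _ _ _ _ μ _ Γ _ _ S hS n k hdiam hY _ hLip hk hμ
  have : Nonempty Y := μ.nonempty_of_neZero
  refine ⟨exists_net_level S hS hdiam hY, ?_, ?_⟩
  · intro E _ _ _ p hp _ hgap A
    exact exists_log_le_distortion μ hS n hk hLip hμ E hp hgap A
  · intro p hp _ hgap A
    obtain ⟨c, hc, h⟩ := exists_log_le_distortion μ hS n hk hLip hμ _ hp hgap A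
    refine ⟨c, hc, fun t Z hfin hZ hcard => ⟨h t Z hfin hZ hcard, ?_⟩⟩
    have := hfin.to_subtype
    obtain ⟨y⟩ := ‹Nonempty Y›
    obtain ⟨z, hz, -⟩ := hZ.2 (y, t) rfl
    have : Nonempty Z := ⟨⟨z, hz⟩⟩
    exact distortion_lp_le_log Z
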